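/- Let $\Bbbk$ be a field, and let $n\ge 6$ and $r\ge 0$ be integers. Write $[m]=\{1,\dots,m\}$. Let $H_n$ be the graph on the vertices $x_{r+1},\dots,x_{r+n}$ with edge set $$\{x_{r+i}x_{r+i+1} : i\in[n-5]\}\cup\{x_{r+n-4}x_{r+n-2},\,x_{r+n-2}x_{r+n-3}\}\cup\{x_{r+n-1}x_{r+j} : j\in[n]\setminus\{1,n-1\}\}\cup\{x_{r+n}x_{r+j} : j\in[n]\setminus\{n-3,n\}\},$$ and let $CH_{n,r}$ be the graph on the vertices $x_1,\dots,x_{r+n}$ with edge set $$E(H_n)\cup\{x_ix_j : i,j\in[r],\ i\ne j\}\cup\{x_ix_{r+j} : i\in[r],\ j\in\{n-1,n\}\}.$$ Let $CH_{n,r}^c$ be its complement and let $I=I(CH_{n,r}^c)\subset S=\Bbbk[x_1,\dots,x_{r+n}]$ be the edge ideal, generated by the products $x_ix_j$ over the edges $\{x_i,x_j\}$ of $CH_{n,r}^c$. For $k\ge 0$, let $HS_k(CH_{n,r}^c)$ be the $k$-th homological shift ideal of $I$: if $\cdots\to F_1\to F_0\to 0$ is the minimal multigraded free resolution of $I$ over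 $S$ and $F_k=\bigoplus_j S(-\mathbf a_{kj})$ with $\mathbf a_{kj}\in\mathbb N^{r+n}$, then $HS_k(CH_{n,r}^c)$ is the ideal generated by the monomials $\mathbf x^{\mathbf a_{kj}}$. A monomial ideal has linear quotients if its minimal monomial generators can be ordered as $m_1,\dots,m_q$ so that, for every $1\le i<q$, the ideal $(m_1,\dots,m_i):m_{i+1}$ is generated by variables. Then: 1. if $2\le k<n-4$ or $n-4<k\le n+r-4$, then $HS_k(CH_{n,r}^c)$ is nonzero and has linear quotients; 2. $HS_{n-4}(CH_{n,r}^c)$ is nonzero and does not have linear quotients; 3. if $k>n+r-4$, then $HS_k(CH_{n,r}^c)=0$. -/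

import Mathlib

open MvPolynomial

noncomputable section

/-- The edge ideal of a simple graph `G`: it is generated by the products `x_u x_v` over the
edges `{u, v}` of `G`. -/
def edgeIdeal (K : Type*) [Field K] {σ : Type*} (G : SimpleGraph σ) : Ideal (MvPolynomial σ K) :=
  Ideal.span {p | ∃ u v, G.Adj u v ∧ p = X u * X v}

/-- A minimal multigraded free resolution
`⋯ → F 2 → F 1 → F 0 → I → 0` of an ideal `I` of `S = K[x_v : v ∈ σ]`. Here `F i` is the free
`S`-module of finite rank on the basis `ι i`, and it is multigraded by giving the basis element
`j : ι i` the multidegree `shift i j`, so that `F i = ⨁ j, S(-shift i j)`. -/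
structure MinimalMultigradedResolution {K : Type*} [Field K] {σ : Type*}
    (I : Ideal (MvPolynomial σ K)) where
  /-- The basis of the `i`-th free module. -/
  ι : ℕ → Type
  finite : ∀ i, Finite (ι i)
  /-- The multidegrees of the basis elements. -/
  shift : ∀ i, ι i → (σ →₀ ℕ)
  /-- The differential `F (i + 1) → F i`. -/
  d : ∀ i, (ι (i + 1) →₀ MvPolynomial σ K) →ₗ[MvPolynomial σ K] (ι i →₀ MvPolynomial σ K)
  /-- The augmentation `F 0 → S`, with image `I`. -/
  aug : (ι 0 →₀ MvPolynomial σ K) →ₗ[MvPolynomial σ K] MvPolynomial σ K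
  /-- The differentials preserve multidegrees: every term `x^e` of the entry of the differential
  at the basis elements `j` and `l` has `shift i l + e = shift (i + 1) j`. -/
  d_homogeneous : ∀ i (j : ι (i + 1)) (l : ι i),
    ∀ e ∈ (d i (Finsupp.single j 1) l).support, shift i l + e = shift (i + 1) j
  /-- The augmentation preserves multidegrees. -/
  aug_homogeneous : ∀ j : ι 0, ∀ e ∈ (aug (Finsupp.single j 1)).support, e = shift 0 j
  range_aug : LinearMap.range aug = I
  exact_zero : Function.Exact (d 0) aug
  exact_succ : ∀ i, Function.Exact (d (i + 1)) (d i)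
  /-- The image of each differential lies in `(x_v : v ∈ σ) F i`. -/
  minimal : ∀ i, LinearMap.range (d i) ≤
    (Ideal.span (Set.range (X : σ → MvPolynomial σ K))) •
      (⊤ : Submodule (MvPolynomial σ K) (ι i →₀ MvPolynomial σ K))

/-- The `k`-th homological shift ideal of `I`: it is generated by the monomials `x^a`, where `a`
runs over the multidegrees of the basis elements in homological degree `k` of a minimal multigraded
free resolution of `I`. (These multidegrees do not depend on the resolution.) -/
def homologicalShiftIdeal {K : Type*} [Field K] {σ : Type*} (k : ℕ)
    (I : Ideal (MvPolynomial σ K)) : Ideal (MvPolynomial σ K) :=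
  Ideal.span {p | ∃ (F : MinimalMultigradedResolution I) (j : F.ι k),
    p = monomial (F.shift k j) (1 : K)}

/-- The exponents of the minimal monomial generators of a monomial ideal `I`, that is, of the
monomials in `I` that are minimal with respect to divisibility. -/
def minGens {K : Type*} [Field K] {σ : Type*} (I : Ideal (MvPolynomial σ K)) : Set (σ →₀ ℕ) :=
  {a | Minimal (fun b => monomial b (1 : K) ∈ I) a}

/-- A monomial ideal `I` has linear quotients if its minimal monomial generators can be ordered as
`m_1, …, m_q` so that each colon ideal `(m_1, …, m_{i-1}) : m_i` is generated by a set of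
variables. -/
def HasLinearQuotients {K : Type*} [Field K] {σ : Type*} (I : Ideal (MvPolynomial σ K)) : Prop :=
  ∃ (q : ℕ) (m : Fin q → (σ →₀ ℕ)), Function.Injective m ∧ Set.range m = minGens I ∧
    ∀ i : Fin q, ∃ T : Set σ,
      (Ideal.span {p | ∃ l : Fin q, l < i ∧ p = monomial (m l) (1 : K)}).colon
        {monomial (m i) (1 : K)} = Ideal.span (X '' T)

/-- The edges `{a, b}` of the graph `H_n`, in terms of the labels `1, …, n` of its vertices. -/
def HEdge (n a b : ℕ) : Prop :=
  (1 ≤ a ∧ a ≤ n - 5 ∧ b = a + 1) ∨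
  (a = n - 4 ∧ b = n - 2) ∨
  (a = n - 2 ∧ b = n - 3) ∨
  (a = n - 1 ∧ 1 ≤ b ∧ b ≤ n ∧ b ≠ 1 ∧ b ≠ n - 1) ∨
  (a = n ∧ 1 ≤ b ∧ b ≤ n ∧ b ≠ n - 3 ∧ b ≠ n)

/-- The edges `{a, b}` of the graph `CH_{n,r}`, in terms of the labels `1, …, r + n` of its
vertices: a copy of `H_n` on the labels `r + 1, …, r + n`, all pairs of distinct labels in
`1, …, r`, and the pairs of a label in `1, …, r` with `r + (n - 1)` or `r + n`. -/
def CHEdge (n r a b : ℕ) : Prop :=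
  (∃ i j, HEdge n i j ∧ a = r + i ∧ b = r + j) ∨
  (1 ≤ a ∧ a ≤ r ∧ 1 ≤ b ∧ b ≤ r ∧ a ≠ b) ∨
  (1 ≤ a ∧ a ≤ r ∧ (b = r + (n - 1) ∨ b = r + n))

/-- The graph `CH_{n,r}` (meant for `6 ≤ n`). The vertex `v : Fin (r + n)` carries the label
`v + 1`. -/
def CH (n r : ℕ) : SimpleGraph (Fin (r + n)) :=
  SimpleGraph.fromRel fun u v => CHEdge n r (u + 1) (v + 1)

end

/-! A monomial lies in the edge ideal of `Gᶜ` exactly when its support is not a clique of `G`. For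
chordal `G`, the multidegrees in homological degree `k` of a minimal resolution are the squarefree
ones whose support `W` has `k + 2` vertices and induces a disconnected subgraph
(`MinimalMultigradedResolution.exists_shift_eq_iff`). This is Fröberg's theorem together with its
multidegrees.

It is proved without Hochster's formula. Setting all variables of the resolution of `S / I` to `1`
gives a complex of vector spaces filtered by degree. By minimality, a degree `W` in `I` occurs in
level `t + 1` iff the part strictly below `W` is not exact in level `t` (`not_acyclic_Iio`,
`exists_shift_eq`). Exactness is then decided by Mayer–Vietoris and induction on `W`, removing a
simplicial vertex (`acyclic_Iio`, `not_acyclic_Iio_of_isDisconnectedOn`).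

In `CH n r`, put `M = r + n - 2`: a clique on the labels up to `r`, a path on `r + 1, …, M`, and two
vertices `M + 1`, `M + 2`, each missing just one other vertex, namely `r + 1` and `M` respectively.
Hence disconnected sets have three types (`isDisconnectedOn_iff`): those inside the labels up to
`M`, those with `M + 2` where `M` is isolated, and those with `M + 1` where `r + 1` is isolated.
They have at most `M` elements, and every size from `2` to `M` occurs, which settles vanishing.

Ordering the sets by type and then by reverse colex order gives linear quotients, through an
exchange property. The one dangerous exchange replaces `M + 1` by `r + 2` in a set of the third
type; it fails only if the result is the whole path, which is connected and has `M - r = n - 2`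
vertices. That size is `k = n - 4`. There, two sets of the last two types differ by two elements
each way, and no third generator divides their least common multiple
(`not_hasLinearQuotients_of_pair`). -/

noncomputable section

/-- A minimal free resolution of `S / I` with all variables set to `1`, filtered by the degrees of
the basis elements, which lie in a poset `P`. The module in level `0` is spanned by `base`, and the
subcomplex of the degrees `≤ b` is exact in positive levels; it is exact in level `0` for
`b ∈ I`. -/
structure StrandComplex (K : Type*) [Field K] (P : Type*) [PartialOrder P] [OrderBot P]
    (I : Set P) where
  ι : ℕ → Type
  shift : ∀ t, ι t → P
  base : ι 0
  eq_base : ∀ l : ι 0, l = base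
  shift_base : shift 0 base = ⊥
  δ : ∀ t, (ι (t + 1) →₀ K) →ₗ[K] (ι t →₀ K)
  shift_lt : ∀ t j l, δ t (Finsupp.single j 1) l ≠ 0 → shift t l < shift (t + 1) j
  δ_δ : ∀ t z, δ t (δ (t + 1) z) = 0
  exact_Iic : ∀ b t, ∀ z ∈ Finsupp.supported K K (shift (t + 1) ⁻¹' Set.Iic b), δ t z = 0 →
    ∃ u ∈ Finsupp.supported K K (shift (t + 1 + 1) ⁻¹' Set.Iic b), δ (t + 1) u = z
  exact_base : ∀ b ∈ I, ∃ u ∈ Finsupp.supported K K (shift 1 ⁻¹' Set.Iic b),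
    δ 0 u = Finsupp.single base 1
  mem_of_δ_base : ∀ j, δ 0 (Finsupp.single j 1) base ≠ 0 → shift 1 j ∈ I

/-! ### Exactness of the strands and Mayer–Vietoris -/

namespace StrandComplex

variable {K : Type*} [Field K] {P : Type*} [PartialOrder P] [OrderBot P] {I : Set P}
  (C : StrandComplex K P I)

/-- The span of the basis elements in level `t` whose degree is in `D`. -/
def V (t : ℕ) (D : Set P) : Submodule K (C.ι t →₀ K) :=
  Finsupp.supported K K (C.shift t ⁻¹' D)

/-- Cycles in level `t`. -/
def IsCycle : ∀ t, (C.ι t →₀ K) → Prop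
  | 0, _ => True
  | t + 1, z => C.δ t z = 0

/-- The part of the complex in degrees `D` is exact in level `t`. -/
def Acyclic (t : ℕ) (D : Set P) : Prop :=
  ∀ z ∈ C.V t D, C.IsCycle t z → ∃ u ∈ C.V (t + 1) D, C.δ t u = z

lemma isCycle_δ (t : ℕ) (z) : C.IsCycle t (C.δ t z) := by
  cases t with
  | zero => trivial
  | succ t => exact C.δ_δ t z

lemma IsCycle.sub {t : ℕ} {z w} (hz : C.IsCycle t z) (hw : C.IsCycle t w) :
    C.IsCycle t (z - w) := by
  cases t with
  | zero => trivial
  | succ t =>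
    change C.δ t _ = 0
    rw [map_sub, show C.δ t z = 0 from hz, show C.δ t w = 0 from hw, sub_zero]

lemma V_mono {t : ℕ} {D E : Set P} (h : D ⊆ E) : C.V t D ≤ C.V t E :=
  Finsupp.supported_mono (Set.preimage_mono h)

lemma V_union (t : ℕ) (D E : Set P) : C.V t (D ∪ E) = C.V t D ⊔ C.V t E :=
  Finsupp.supported_union _ _

lemma V_inter (t : ℕ) (D E : Set P) : C.V t (D ∩ E) = C.V t D ⊓ C.V t E :=
  Finsupp.supported_inter _ _

lemma single_mem_V {t : ℕ} {D : Set P} {j : C.ι t} (h : C.shift t j ∈ D) (c : K) :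
    Finsupp.single j c ∈ C.V t D :=
  Finsupp.single_mem_supported K c h

lemma V_congr {t : ℕ} {D E : Set P} (h : ∀ l, C.shift t l ∈ D ↔ C.shift t l ∈ E) :
    C.V t D = C.V t E := by
  have : C.shift t ⁻¹' D = C.shift t ⁻¹' E := Set.ext h
  rw [V, V, this]

lemma acyclic_congr {t : ℕ} {D E : Set P} (h : ∀ t l, C.shift t l ∈ D ↔ C.shift t l ∈ E) :
    C.Acyclic t D ↔ C.Acyclic t E := by
  rw [Acyclic, Acyclic, C.V_congr (h t), C.V_congr (h (t + 1))]

lemma δ_mem_V_of_lt {t : ℕ} {D E : Set P} (h : ∀ p ∈ D, ∀ q < p, q ∈ E) {z}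
    (hz : z ∈ C.V (t + 1) D) : C.δ t z ∈ C.V t E := by
  have : C.V (t + 1) D ≤ (C.V t E).comap (C.δ t) := by
    rw [V, Finsupp.supported_eq_span_single, Submodule.span_le]
    rintro _ ⟨j, hj, rfl⟩
    intro l hl
    exact h _ hj _ (C.shift_lt t j l (Finsupp.mem_support_iff.1 hl))
  exact this hz

lemma δ_mem_V {t : ℕ} {D : Set P} (h : IsLowerSet D) {z} (hz : z ∈ C.V (t + 1) D) :
    C.δ t z ∈ C.V t D :=
  C.δ_mem_V_of_lt (fun _ hp _ hq => h hq.le hp) hz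

lemma acyclic_Iic {t : ℕ} {b : P} (h : t ≠ 0 ∨ b ∈ I) : C.Acyclic t (Set.Iic b) := by
  intro z hz hc
  cases t with
  | succ t => exact C.exact_Iic b t z hz hc
  | zero =>
    obtain ⟨u, hu, hu'⟩ := C.exact_base b (h.resolve_left (by simp))
    refine ⟨z C.base • u, (C.V 1 _).smul_mem _ hu, ?_⟩
    rw [map_smul, hu']
    ext l
    rw [C.eq_base l]
    simp

lemma acyclic_union_zero {D E : Set P} (hD : C.Acyclic 0 D) (hE : C.Acyclic 0 E) :
    C.Acyclic 0 (D ∪ E) := by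
  intro z hz _
  rw [V_union] at hz
  obtain ⟨x, hx, y, hy, rfl⟩ := Submodule.mem_sup.1 hz
  obtain ⟨u, hu, rfl⟩ := hD x hx trivial
  obtain ⟨w, hw, rfl⟩ := hE y hy trivial
  exact ⟨u + w, by rw [V_union]; exact Submodule.add_mem_sup hu hw, map_add _ _ _⟩

/-- A piece of the Mayer–Vietoris sequence of two subcomplexes: the connecting map sends the class
of `x + y` to that of `δ x = -δ y` in the intersection. -/
lemma acyclic_union {t : ℕ} {D E : Set P} (lD : IsLowerSet D) (lE : IsLowerSet E)
    (hD : C.Acyclic (t + 1) D) (hE : C.Acyclic (t + 1) E) (hDE : C.Acyclic t (D ∩ E)) :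
    C.Acyclic (t + 1) (D ∪ E) := by
  intro z hz hc
  rw [V_union] at hz
  obtain ⟨x, hx, y, hy, rfl⟩ := Submodule.mem_sup.1 hz
  have hxy : C.δ t x = - C.δ t y := by
    rw [← add_eq_zero_iff_eq_neg, ← map_add]; exact hc
  obtain ⟨w, hw, hw'⟩ := hDE (C.δ t x) (by
    rw [V_inter]
    refine ⟨C.δ_mem_V lD hx, ?_⟩
    rw [hxy]
    exact neg_mem (C.δ_mem_V lE hy)) (C.isCycle_δ t x)
  rw [V_inter] at hw
  obtain ⟨u, hu, hu'⟩ := hD (x - w) (sub_mem hx hw.1)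
    (show C.δ t _ = 0 by rw [map_sub, hw', sub_self])
  obtain ⟨u', hv, hv'⟩ := hE (y + w) (add_mem hy hw.2)
    (show C.δ t _ = 0 by rw [map_add, hw', hxy, add_neg_cancel])
  refine ⟨u + u', by rw [V_union]; exact Submodule.add_mem_sup hu hv, ?_⟩
  rw [map_add, hu', hv']
  abel

/-- Injectivity of the connecting map: two fillings of `z`, one in each part, differ by a cycle of
the union, and its filling corrects them to a common one. -/
lemma acyclic_inter {t : ℕ} {D E : Set P} (lD : IsLowerSet D) (lE : IsLowerSet E)
    (hD : C.Acyclic t D) (hE : C.Acyclic t E) (hDE : C.Acyclic (t + 1) (D ∪ E)) :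
    C.Acyclic t (D ∩ E) := by
  intro z hz hc
  rw [V_inter] at hz
  obtain ⟨u, hu, hu'⟩ := hD z hz.1 hc
  obtain ⟨v, hv, hv'⟩ := hE z hz.2 hc
  obtain ⟨w, hw, hw'⟩ := hDE (u - v) (by
    rw [V_union]; exact sub_mem (Submodule.mem_sup_left hu) (Submodule.mem_sup_right hv))
    (show C.δ t _ = 0 by rw [map_sub, hu', hv', sub_self])
  rw [V_union] at hw
  obtain ⟨x, hx, y, hy, rfl⟩ := Submodule.mem_sup.1 hw
  have key : u - C.δ _ x = v + C.δ _ y := by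
    rw [map_add] at hw'
    rw [sub_eq_iff_eq_add, add_assoc, add_comm (C.δ _ y), hw']
    abel
  refine ⟨u - C.δ _ x, ?_, ?_⟩
  · rw [V_inter]
    refine ⟨sub_mem hu (C.δ_mem_V lD hx), ?_⟩
    rw [key]
    exact add_mem hv (C.δ_mem_V lE hy)
  · rw [map_sub, C.δ_δ, sub_zero, hu']

lemma acyclic_left {t : ℕ} {D E : Set P} (lD : IsLowerSet D) (lE : IsLowerSet E)
    (h : C.Acyclic t (D ∪ E)) (hDE : C.Acyclic t (D ∩ E)) : C.Acyclic t D := by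
  intro z hz hc
  obtain ⟨u, hu, hu'⟩ := h z (C.V_mono Set.subset_union_left hz) hc
  rw [V_union] at hu
  obtain ⟨x, hx, y, hy, rfl⟩ := Submodule.mem_sup.1 hu
  have key : z - C.δ t x = C.δ t y := by rw [← hu', map_add]; abel
  obtain ⟨w, hw, hw'⟩ := hDE (z - C.δ t x) (by
    rw [V_inter]
    refine ⟨sub_mem hz (C.δ_mem_V lD hx), ?_⟩
    rw [key]
    exact C.δ_mem_V lE hy) (hc.sub C (C.isCycle_δ t x))
  rw [V_inter] at hw
  exact ⟨x + w, add_mem hx hw.1, by rw [map_add, hw']; abel⟩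

/-- Only basis elements with degree in `I` have a nonzero boundary in level `0`, so outside `I` the
base is not a boundary. -/
lemma not_acyclic_zero {D : Set P} (h0 : ⊥ ∈ D) (hD : ∀ b ∈ D, b ∉ I) : ¬ C.Acyclic 0 D := by
  intro h
  obtain ⟨u, hu, hu'⟩ := h (Finsupp.single C.base 1)
    (C.single_mem_V (by rwa [C.shift_base]) 1) trivial
  have hz : C.V 1 D ≤ LinearMap.ker (C.δ 0) := by
    rw [V, Finsupp.supported_eq_span_single, Submodule.span_le]
    rintro _ ⟨j, hj, rfl⟩
    refine LinearMap.mem_ker.2 (Finsupp.ext fun l => ?_)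
    rw [C.eq_base l]
    by_contra hne
    exact hD _ hj (C.mem_of_δ_base j hne)
  have := LinearMap.mem_ker.1 (hz hu)
  rw [hu'] at this
  simp at this

/-- A basis element whose boundary lies in degrees `D` not containing its own degree obstructs
exactness of the part in degrees `D`. -/
lemma not_acyclic_of_δ_mem {t : ℕ} (j : C.ι (t + 1)) {D : Set P}
    (hjD : C.shift (t + 1) j ∉ D) (hD : D ⊆ Set.Iic (C.shift (t + 1) j))
    (hδ : C.δ t (Finsupp.single j 1) ∈ C.V t D) : ¬ C.Acyclic t D := by
  intro h
  obtain ⟨u, hu, hu'⟩ := h _ hδ (C.isCycle_δ t _)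
  obtain ⟨w, hw, hw'⟩ := C.exact_Iic (C.shift (t + 1) j) t (Finsupp.single j 1 - u)
    (sub_mem (C.single_mem_V (Set.self_mem_Iic) 1) (C.V_mono hD hu))
    (by rw [map_sub, hu', sub_self])
  -- Minimality enters here: boundaries strictly lower degrees, so `j` has coefficient `0` in `δ w`,
  -- but it has coefficient `1` in `single j 1 - u` because `u` avoids the degree of `j`.
  have h1 : C.δ (t + 1) w ∈ C.V (t + 1) (Set.Iio (C.shift (t + 1) j)) :=
    C.δ_mem_V_of_lt (fun p hp q hq => hq.trans_le hp) hw
  have h2 : u j = 0 := by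
    by_contra hne
    exact hjD (hu (Finsupp.mem_support_iff.2 hne))
  have h3 : C.δ (t + 1) w j = 0 := by
    by_contra hne
    exact lt_irrefl _ (h1 (Finsupp.mem_support_iff.2 hne))
  rw [hw'] at h3
  simp [h2] at h3

lemma not_acyclic_Iio {t : ℕ} (j : C.ι (t + 1)) :
    ¬ C.Acyclic t (Set.Iio (C.shift (t + 1) j)) :=
  C.not_acyclic_of_δ_mem j (lt_irrefl _) Set.Iio_subset_Iic_self
    (fun l hl => C.shift_lt t j l (Finsupp.mem_support_iff.1 hl))

lemma exists_δ_ne_zero {t : ℕ} (j : C.ι (t + 1)) : ∃ l, C.δ t (Finsupp.single j 1) l ≠ 0 := by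
  by_contra! h
  refine C.not_acyclic_of_δ_mem j (D := ∅) (by simp) (by simp) ?_ ?_
  · rw [Finsupp.ext (g := 0) h]
    exact zero_mem _
  · intro z hz _
    have : z = 0 := by simpa [V] using hz
    exact ⟨0, zero_mem _, by simp [this]⟩

lemma shift_mem (hI : IsUpperSet I) : ∀ (t : ℕ) (j : C.ι (t + 1)), C.shift (t + 1) j ∈ I
  | 0, j => by
    obtain ⟨l, hl⟩ := C.exists_δ_ne_zero j
    rw [C.eq_base l] at hl
    exact C.mem_of_δ_base j hl
  | t + 1, j => by
    obtain ⟨l, hl⟩ := C.exists_δ_ne_zero j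
    exact hI (C.shift_lt _ j l hl).le (shift_mem hI t l)

/-- If no basis element has degree `a`, the parts below `a` and up to `a` agree in level `t + 1`,
and the latter is exact. -/
lemma exists_shift_eq {t : ℕ} {a : P} (ha : t ≠ 0 ∨ a ∈ I) (h : ¬ C.Acyclic t (Set.Iio a)) :
    ∃ j, C.shift (t + 1) j = a := by
  by_contra! hne
  refine h fun z hz hc => ?_
  obtain ⟨u, hu, hu'⟩ := C.acyclic_Iic ha z (C.V_mono Set.Iio_subset_Iic_self hz) hc
  refine ⟨u, ?_, hu'⟩
  rwa [C.V_congr (E := Set.Iic a)]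
  exact fun l => ⟨fun h => le_of_lt h, fun h => lt_of_le_of_ne h (hne l)⟩

lemma acyclic_of_disjoint (hI : IsUpperSet I) {t : ℕ} (ht : t ≠ 0) {D : Set P}
    (hD : ∀ b ∈ D, b ∉ I) : C.Acyclic t D := by
  intro z hz _
  obtain ⟨t, rfl⟩ := Nat.exists_eq_succ_of_ne_zero ht
  have : z = 0 := by
    ext l
    by_contra hne
    exact hD _ (hz (Finsupp.mem_support_iff.2 hne)) (C.shift_mem hI t l)
  exact ⟨0, zero_mem _, by simp [this]⟩

end StrandComplex

/-! ### Disconnected vertex sets and the sets of faces used in the induction -/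

section Disconnected

variable {σ : Type*} [DecidableEq σ]

/-- The induced subgraph of `G` on `W` splits into two nonempty parts without edges between
them. -/
def IsDisconnectedOn (G : SimpleGraph σ) (W : Finset σ) : Prop :=
  ∃ A B : Finset σ, A.Nonempty ∧ B.Nonempty ∧ Disjoint A B ∧ A ∪ B = W ∧
    ∀ x ∈ A, ∀ y ∈ B, ¬ G.Adj x y

/-- The sets of vertices that are not cliques. -/
def nonCliques (G : SimpleGraph σ) : Set (Finset σ) :=
  {W | ∃ x ∈ W, ∃ y ∈ W, x ≠ y ∧ ¬ G.Adj x y}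

/-- Every nonempty set of vertices has an element whose neighbours in the set form a clique. -/
def IsChordal (G : SimpleGraph σ) : Prop :=
  ∀ W : Finset σ, W.Nonempty → ∃ v ∈ W, ∀ x ∈ W, ∀ y ∈ W, G.Adj v x → G.Adj v y → x ≠ y →
    G.Adj x y

/-- The sets contained in `W.erase u` for some `u ∈ U`. -/
def facets (W U : Finset σ) : Set (Finset σ) := {b | ∃ u ∈ U, b ⊆ W.erase u}

variable {G : SimpleGraph σ}

omit [DecidableEq σ] in
lemma isUpperSet_nonCliques : IsUpperSet (nonCliques G) := by
  rintro W W' h ⟨x, hx, y, hy, hxy⟩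
  exact ⟨x, h hx, y, h hy, hxy⟩

lemma isLowerSet_facets (W U : Finset σ) : IsLowerSet (facets W U) := by
  rintro b c h ⟨u, hu, hb⟩
  exact ⟨u, hu, h.trans hb⟩

lemma facets_insert (W U : Finset σ) (u : σ) :
    facets W (insert u U) = facets W U ∪ Set.Iic (W.erase u) := by
  ext b
  simp [facets, or_comm]

lemma facets_singleton (W : Finset σ) (u : σ) : facets W {u} = Set.Iic (W.erase u) := by
  ext b
  simp [facets]

/-- Adding one facet at a time, the intersection in Mayer–Vietoris is again of the same form on a
smaller vertex set. -/
lemma facets_inter_Iic (W U : Finset σ) (u : σ) :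
    facets W U ∩ Set.Iic (W.erase u) = facets (W.erase u) U := by
  ext b
  constructor
  · rintro ⟨⟨v, hv, hb⟩, hb' : b ⊆ _⟩
    refine ⟨v, hv, fun x hx => ?_⟩
    have h1 := hb hx
    have h2 := hb' hx
    simp only [Finset.mem_erase] at *
    tauto
  · rintro ⟨v, hv, hb⟩
    have h : ∀ x ∈ b, x ≠ v ∧ x ≠ u ∧ x ∈ W := fun x hx => by simpa using hb hx
    exact ⟨⟨v, hv, fun x hx => by simp [h x hx]⟩,
      show b ⊆ _ from fun x hx => by simp [h x hx]⟩

lemma facets_self (W : Finset σ) : facets W W = Set.Iio W := by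
  ext b
  exact (Finset.ssubset_iff_exists_subset_erase (s := b) (t := W)).symm

lemma IsDisconnectedOn.mem_nonCliques {W : Finset σ} (h : IsDisconnectedOn G W) :
    W ∈ nonCliques G := by
  obtain ⟨A, B, ⟨x, hx⟩, ⟨y, hy⟩, hd, rfl, h⟩ := h
  exact ⟨x, by simp [hx], y, by simp [hy], fun e => Finset.disjoint_left.1 hd hx (e ▸ hy),
    h x hx y hy⟩

/-- One may assume that a given vertex lies in the first part. -/
lemma IsDisconnectedOn.exists_mem {W : Finset σ} (h : IsDisconnectedOn G W) {v : σ} (hv : v ∈ W) :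
    ∃ A B : Finset σ, v ∈ A ∧ B.Nonempty ∧ Disjoint A B ∧ A ∪ B = W ∧
      ∀ x ∈ A, ∀ y ∈ B, ¬ G.Adj x y := by
  obtain ⟨A, B, hA, hB, hd, rfl, h⟩ := h
  rcases Finset.mem_union.1 hv with hv | hv
  · exact ⟨A, B, hv, hB, hd, rfl, h⟩
  · exact ⟨B, A, hv, hA, hd.symm, Finset.union_comm _ _, fun x hx y hy e => h y hy x hx e.symm⟩

lemma isDisconnectedOn_of_isolated {W : Finset σ} {v : σ} (hv : v ∈ W)
    (hne : (W.erase v).Nonempty) (h : ∀ x ∈ W, ¬ G.Adj v x) : IsDisconnectedOn G W :=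
  ⟨{v}, W.erase v, by simp, hne, by simp, by simp [hv], fun x hx y hy => by
    rw [Finset.mem_singleton.1 hx]; exact h y (Finset.mem_of_mem_erase hy)⟩

lemma IsDisconnectedOn.erase {W : Finset σ} (h : IsDisconnectedOn G W) {v x : σ} (hv : v ∈ W)
    (hx : x ∈ W) (hvx : G.Adj v x) : IsDisconnectedOn G (W.erase v) := by
  obtain ⟨A, B, hA, hB, hd, rfl, hn⟩ := h.exists_mem hv
  have hxA : x ∈ A := (Finset.mem_union.1 hx).resolve_right fun hxB => hn v hA x hxB hvx
  refine ⟨A.erase v, B, ⟨x, Finset.mem_erase.2 ⟨hvx.ne', hxA⟩⟩, hB,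
    hd.mono_left (Finset.erase_subset _ _), ?_,
    fun y hy => hn y (Finset.mem_of_mem_erase hy)⟩
  rw [Finset.erase_union_distrib, Finset.erase_eq_of_notMem (s := B)]
  exact Finset.disjoint_left.1 hd hA

/-- The neighbours of a simplicial vertex form a clique, hence lie in a single part, and the vertex
may be added to that part. -/
lemma IsDisconnectedOn.of_erase {W : Finset σ} {v x : σ} (hv : v ∈ W) (hx : x ∈ W)
    (hvx : G.Adj v x) (hcl : ∀ x ∈ W, ∀ y ∈ W, G.Adj v x → G.Adj v y → x ≠ y → G.Adj x y)
    (h : IsDisconnectedOn G (W.erase v)) : IsDisconnectedOn G W := by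
  obtain ⟨A, B, hA, hB, hd, hAB, hn⟩ := h.exists_mem (Finset.mem_erase.2 ⟨hvx.ne', hx⟩)
  have hB' : ∀ y ∈ B, y ≠ v ∧ y ∈ W := fun y hy => by
    rw [← Finset.mem_erase, ← hAB]
    exact Finset.mem_union_right A hy
  refine ⟨insert v A, B, by simp, hB, ?_, ?_, ?_⟩
  · exact Finset.disjoint_insert_left.2 ⟨fun hv => (hB' v hv).1 rfl, hd⟩
  · rw [Finset.insert_union, hAB, Finset.insert_erase hv]
  · intro y hy z hz hyz
    rcases Finset.mem_insert.1 hy with rfl | hy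
    · exact hn x hA z hz (hcl x hx z (hB' z hz).2 hvx hyz fun e =>
        Finset.disjoint_left.1 hd hA (e ▸ hz))
    · exact hn y hy z hz hyz

end Disconnected

/-! ### Degrees of the strand complex of a chordal graph -/

namespace StrandComplex

variable {K : Type*} [Field K] {σ : Type*} [DecidableEq σ] {G : SimpleGraph σ}
  (C : StrandComplex K (Finset σ) (nonCliques G))

/-- All intersections of these facets contain the non-clique `W \ U`, so each is exact in every
level and Mayer–Vietoris assembles them. -/
lemma acyclic_facets_of_sdiff_mem {U : Finset σ} (hU : U.Nonempty) :
    ∀ (W : Finset σ) (t : ℕ), W \ U ∈ nonCliques G → C.Acyclic t (facets W U) := by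
  induction hU using Finset.Nonempty.cons_induction with
  | singleton u =>
    intro W t h
    rw [facets_singleton]
    exact C.acyclic_Iic (Or.inr (by rwa [Finset.sdiff_singleton_eq_erase] at h))
  | cons u U hu hU ih =>
    intro W t h
    rw [Finset.cons_eq_insert] at *
    have h1 : W \ U ∈ nonCliques G :=
      isUpperSet_nonCliques (Finset.sdiff_subset_sdiff le_rfl (Finset.subset_insert _ _)) h
    have h2 : W.erase u ∈ nonCliques G := isUpperSet_nonCliques (fun x hx => by
      simp only [Finset.mem_sdiff, Finset.mem_insert, Finset.mem_erase] at *; tauto) h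
    have h3 : W.erase u \ U ∈ nonCliques G := isUpperSet_nonCliques (fun x hx => by
      simp only [Finset.mem_sdiff, Finset.mem_insert, Finset.mem_erase] at *; tauto) h
    rw [facets_insert]
    cases t with
    | zero => exact C.acyclic_union_zero (ih _ _ h1) (C.acyclic_Iic (Or.inr h2))
    | succ t =>
      refine C.acyclic_union (isLowerSet_facets _ _) (isLowerSet_Iic _) (ih _ _ h1)
        (C.acyclic_Iic (Or.inr h2)) ?_
      rw [facets_inter_Iic]
      exact ih _ _ h3

lemma insert_union_erase {v q : σ} {N Q : Finset σ} (hvq : v ≠ q) (hqN : q ∉ N) (hqQ : q ∉ Q) :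
    (insert v (N ∪ insert q Q)).erase q = insert v (N ∪ Q) := by
  ext x
  simp only [Finset.mem_erase, Finset.mem_insert, Finset.mem_union]
  constructor
  · tauto
  · rintro (rfl | h | h)
    · exact ⟨hvq, by tauto⟩
    · exact ⟨fun e => hqN (e ▸ h), by tauto⟩
    · exact ⟨fun e => hqQ (e ▸ h), by tauto⟩

/-- `N` are the neighbours and `Q` the other vertices for a simplicial vertex `v` of
`insert v (N ∪ Q)`. -/
lemma acyclic_facets_erase {v : σ} {N Q : Finset σ} (hQ : Q.Nonempty) (hvN : v ∉ N)
    (hN : insert v N ∉ nonCliques G) : ∀ t : ℕ, v ∉ Q → Disjoint N Q → (∀ q ∈ Q, ¬ G.Adj v q) →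
    (N.Nonempty ∨ t + 1 ≠ Q.card) → C.Acyclic t (facets (insert v (N ∪ Q)) (N ∪ Q)) := by
  induction hQ using Finset.Nonempty.cons_induction with
  | singleton q =>
    intro t hvQ hNQ hadj ht
    have hvq : v ≠ q := by simpa using hvQ
    have hqN : q ∉ N := by simpa using hNQ
    have e : (insert v (N ∪ {q})).erase q = insert v N := by
      have := insert_union_erase (Q := ∅) hvq hqN (by simp)
      simpa using this
    have e' : N ∪ {q} = insert q N := by rw [Finset.union_comm]; rfl
    have e2 : facets (insert v (N ∪ {q})) (N ∪ {q}) =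
        facets (insert v (N ∪ {q})) N ∪ Set.Iic (insert v N) := by
      conv_lhs => rw [e', facets_insert, ← e', e]
    rcases N.eq_empty_or_nonempty with rfl | hNe
    · have ht0 : t ≠ 0 := by simpa using ht
      rw [e2]
      have : facets (insert v (∅ ∪ {q})) ∅ = ∅ := by simp [facets]
      rw [this, Set.empty_union]
      exact C.acyclic_Iic (Or.inl ht0)
    -- Since `insert v N` is a clique, its only basis element is the base of level `0`, whose degree
    -- is already in `facets _ N` as `N` is nonempty. Removing `N` leaves the nonadjacent pair `v`,
    -- `q`.
    · rw [e2, C.acyclic_congr (E := facets (insert v (N ∪ {q})) N)]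
      · refine C.acyclic_facets_of_sdiff_mem hNe _ _ ⟨v, ?_, q, ?_, hvq, hadj q (by simp)⟩ <;>
          simp [hvN, hqN]
      · intro s l
        refine ⟨fun h => h.elim id fun h' => ?_, Or.inl⟩
        cases s with
        | zero =>
          obtain ⟨x, hx⟩ := hNe
          rw [C.eq_base l, C.shift_base]
          exact ⟨x, hx, bot_le⟩
        | succ s =>
          exact absurd (isUpperSet_nonCliques h' (C.shift_mem isUpperSet_nonCliques s l)) hN
  | cons q Q hq hQ ih =>
    intro t hvQ hNQ hadj ht
    rw [Finset.cons_eq_insert] at *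
    have hvq : v ≠ q := by rintro rfl; simp at hvQ
    have hqN : q ∉ N := fun h => Finset.disjoint_left.1 hNQ h (by simp)
    have hvQ' : v ∉ Q := fun h => hvQ (by simp [h])
    have hNQ' : Disjoint N Q := hNQ.mono_right (Finset.subset_insert _ _)
    have e := insert_union_erase hvq hqN hq
    obtain ⟨q', hq'⟩ := hQ
    -- Removing `N ∪ Q` leaves the non-clique `{v, q}`, so only the last facet matters; its
    -- intersection with the others is the case of `Q`, one level lower.
    have h1 : ∀ t, C.Acyclic t (facets (insert v (N ∪ insert q Q)) (N ∪ Q)) := fun t =>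
      C.acyclic_facets_of_sdiff_mem ⟨q', by simp [hq']⟩ _ t
        ⟨v, by simp [hvN, hvQ'], q, by simp [hqN, hq], hvq, hadj q (by simp)⟩
    have h2 : insert v (N ∪ Q) ∈ nonCliques G := ⟨v, by simp, q', by simp [hq'],
      fun h => hvQ' (h ▸ hq'), hadj q' (by simp [hq'])⟩
    have e2 : facets (insert v (N ∪ insert q Q)) (N ∪ insert q Q) =
        facets (insert v (N ∪ insert q Q)) (N ∪ Q) ∪ Set.Iic (insert v (N ∪ Q)) := by
      rw [← e, ← facets_insert, Finset.union_insert]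
    rw [e2]
    cases t with
    | zero => exact C.acyclic_union_zero (h1 0) (C.acyclic_Iic (Or.inr h2))
    | succ t =>
      refine C.acyclic_union (isLowerSet_facets _ _) (isLowerSet_Iic _) (h1 _)
        (C.acyclic_Iic (Or.inr h2)) ?_
      rw [← e, facets_inter_Iic, e]
      refine ih t hvQ' hNQ' (fun x hx => hadj x (by simp [hx])) (ht.imp_right fun h => ?_)
      rw [Finset.card_insert_of_notMem hq] at h
      omega

/-- The exceptional case `N = ∅` of `acyclic_facets_erase`. Deleting a vertex `q` lowers the level
by one, down to the subsets of `{v}`, where the base is not a boundary. -/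
lemma not_acyclic_facets_isolated {v : σ} {Q : Finset σ} (hQ : Q.Nonempty) :
    ∀ t : ℕ, v ∉ Q → (∀ q ∈ Q, ¬ G.Adj v q) → t + 1 = Q.card →
      ¬ C.Acyclic t (facets (insert v Q) Q) := by
  induction hQ using Finset.Nonempty.cons_induction with
  | singleton q =>
    intro t hv hadj ht
    obtain rfl : t = 0 := by simpa using ht
    have hvq : v ≠ q := by simpa using hv
    rw [facets_singleton]
    refine C.not_acyclic_zero (by simp) ?_
    rintro b (hb : b ⊆ _) ⟨x, hx, y, hy, hxy, _⟩
    have h1 := hb hx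
    have h2 := hb hy
    simp only [Finset.mem_erase, Finset.mem_insert, Finset.mem_singleton] at h1 h2
    exact hxy ((h1.2.resolve_right h1.1).trans (h2.2.resolve_right h2.1).symm)
  | cons q Q hq hQ ih =>
    intro t hv hadj ht h
    rw [Finset.cons_eq_insert] at *
    rw [Finset.card_insert_of_notMem hq] at ht
    obtain ⟨t, rfl⟩ : ∃ s, t = s + 1 := ⟨t - 1, by have := hQ.card_pos; omega⟩
    have hvq : v ≠ q := by rintro rfl; simp at hv
    have hvQ' : v ∉ Q := fun h => hv (by simp [h])
    have e : (insert v (insert q Q)).erase q = insert v Q := by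
      simpa using insert_union_erase (N := ∅) hvq (by simp) hq
    obtain ⟨q', hq'⟩ := id hQ
    have h2 : insert v Q ∈ nonCliques G := ⟨v, by simp, q', by simp [hq'],
      fun h => hvQ' (h ▸ hq'), hadj q' (by simp [hq'])⟩
    rw [facets_insert, e] at h
    refine ih t hvQ' (fun x hx => hadj x (by simp [hx])) (by omega) ?_
    rw [← e, ← facets_inter_Iic, e]
    refine C.acyclic_inter (isLowerSet_facets _ _) (isLowerSet_Iic _) ?_
      (C.acyclic_Iic (Or.inr h2)) h
    exact C.acyclic_facets_of_sdiff_mem hQ _ t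
        ⟨v, by simp [hvQ'], q, by simp [hq], hvq, hadj q (by simp)⟩

/-- Decomposition of `W` for a simplicial vertex `v`. -/
lemma exists_neighbors_split {W : Finset σ} {v : σ} (hv : v ∈ W)
    (hcl : ∀ x ∈ W, ∀ y ∈ W, G.Adj v x → G.Adj v y → x ≠ y → G.Adj x y) :
    ∃ N Q : Finset σ, v ∉ N ∧ v ∉ Q ∧ Disjoint N Q ∧ (∀ x ∈ N, G.Adj v x) ∧
      (∀ q ∈ Q, ¬ G.Adj v q) ∧ insert v N ∉ nonCliques G ∧ N ∪ Q = W.erase v := by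
  classical
  refine ⟨(W.erase v).filter (G.Adj v), (W.erase v).filter (¬ G.Adj v ·), by simp, by simp,
    Finset.disjoint_filter_filter_not _ _ _, by simp, by simp, ?_,
    Finset.filter_union_filter_not_eq _ _⟩
  rintro ⟨x, hx, y, hy, hxy, hadj⟩
  simp only [Finset.mem_insert, Finset.mem_filter, Finset.mem_erase] at hx hy
  rcases hx with rfl | hx
  · rcases hy with rfl | hy
    · exact hxy rfl
    · exact hadj hy.2
  · rcases hy with rfl | hy
    · exact hadj hx.2.symm
    · exact hadj (hcl x hx.1.2 y hy.1.2 hx.2 hy.2 hxy)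

lemma Iio_eq_facets_union {W : Finset σ} {v : σ} (hv : v ∈ W) :
    Set.Iio W = facets W (W.erase v) ∪ Set.Iic (W.erase v) := by
  rw [← facets_insert, Finset.insert_erase hv, facets_self]

lemma facets_erase_inter {W : Finset σ} {v : σ} :
    facets W (W.erase v) ∩ Set.Iic (W.erase v) = Set.Iio (W.erase v) := by
  rw [facets_inter_Iic, facets_self]

/-- A nonadjacent pair in `W` is a proper subset, and its generator already kills the base. -/
lemma acyclic_zero_Iio {W : Finset σ} (hW : W ∈ nonCliques G) (hc : W.card ≠ 2) :
    C.Acyclic 0 (Set.Iio W) := by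
  obtain ⟨x, hx, y, hy, hxy, hadj⟩ := hW
  have hlt : ({x, y} : Finset σ) < W := by
    refine lt_of_le_of_ne (fun z hz => ?_) fun e => hc ?_
    · rcases Finset.mem_insert.1 hz with rfl | hz
      · exact hx
      · rwa [Finset.mem_singleton.1 hz]
    · rw [← e, Finset.card_pair hxy]
  intro z _ _
  obtain ⟨u, hu, hu'⟩ := C.acyclic_Iic (t := 0) (b := ({x, y} : Finset σ))
    (Or.inr ⟨x, by simp, y, by simp, hxy, hadj⟩) z (fun l _ => by
      rw [C.eq_base l, Set.mem_preimage, C.shift_base]; exact Finset.empty_subset _) trivial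
  exact ⟨u, C.V_mono (fun b hb => lt_of_le_of_lt hb hlt) hu, hu'⟩

/-- For a simplicial vertex `v`, `Iio W` is the union of the sets omitting some vertex other than
`v` and of `Iic (W.erase v)`; these meet in `Iio (W.erase v)`, so induction applies one level lower.
If `v` has neighbours in `W`, disconnectedness passes from `W.erase v` to `W`; if it has none, `W`
is itself disconnected. -/
lemma acyclic_Iio (hG : IsChordal G) : ∀ (W : Finset σ) (t : ℕ), (t ≠ 0 ∨ W ∈ nonCliques G) →
    (t + 2 ≠ W.card ∨ ¬ IsDisconnectedOn G W) → C.Acyclic t (Set.Iio W) := by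
  intro W
  induction W using Finset.strongInduction with
  | H W ih =>
  intro t ht hW
  by_cases hWn : W ∈ nonCliques G
  swap
  · exact C.acyclic_of_disjoint isUpperSet_nonCliques (ht.resolve_right hWn) fun b hb hb' =>
      hWn (isUpperSet_nonCliques (le_of_lt hb) hb')
  obtain ⟨v, hv, hcl⟩ := hG W (by obtain ⟨x, hx, _⟩ := hWn; exact ⟨x, hx⟩)
  obtain ⟨N, Q, hvN, hvQ, hNQ, hN, hQ, hNc, hU⟩ := exists_neighbors_split hv hcl
  have hWe : W = insert v (N ∪ Q) := by rw [hU, Finset.insert_erase hv]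
  have hQne : Q.Nonempty := by
    by_contra h
    rw [Finset.not_nonempty_iff_eq_empty] at h
    rw [hWe, h, Finset.union_empty] at hWn
    exact hNc hWn
  have hcard : W.card = N.card + Q.card + 1 := by
    rw [hWe, Finset.card_insert_of_notMem (by simp [hvN, hvQ]), Finset.card_union_of_disjoint hNQ]
  have hcond : N.Nonempty ∨ t + 1 ≠ Q.card := by
    refine or_iff_not_imp_left.2 fun h => ?_
    rw [Finset.not_nonempty_iff_eq_empty] at h
    subst h
    have := hW.resolve_right (not_not.2 (isDisconnectedOn_of_isolated hv
      (by rw [← hU]; simpa using hQne) fun x hx hadj => ?_))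
    · simp at hcard
      omega
    · rw [hWe] at hx
      rcases Finset.mem_insert.1 hx with rfl | hx
      · exact G.irrefl hadj
      · exact hQ x (by simpa using hx) hadj
  have hfac : C.Acyclic t (facets W (W.erase v)) := by
    rw [← hU, hWe]
    exact C.acyclic_facets_erase hQne hvN hNc t hvQ hNQ hQ hcond
  cases t with
  | zero =>
    refine C.acyclic_zero_Iio hWn fun hc => ?_
    refine hW.elim (fun h => h hc.symm) fun h => h ?_
    obtain ⟨x, hx, y, hy, hxy, hadj⟩ := hWn
    have : W = {x, y} := (Finset.eq_of_subset_of_card_le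
      (by intro z hz; rcases Finset.mem_insert.1 hz with rfl | hz
          · exact hx
          · rwa [Finset.mem_singleton.1 hz])
      (by rw [hc, Finset.card_pair hxy])).symm
    exact ⟨{x}, {y}, by simp, by simp, by simpa using hxy, by rw [this]; rfl, by simpa using hadj⟩
  | succ t =>
  rw [Iio_eq_facets_union hv]
  by_cases hW' : W.erase v ∈ nonCliques G
  · refine C.acyclic_union (isLowerSet_facets _ _) (isLowerSet_Iic _) hfac
      (C.acyclic_Iic (Or.inl (by simp))) ?_
    rw [facets_erase_inter]
    refine ih _ (Finset.erase_ssubset hv) t (Or.inr hW') ?_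
    rw [Finset.card_erase_of_mem hv]
    by_cases hc : t + 1 + 2 = W.card
    · right
      intro hd
      have hNe : N.Nonempty := by
        by_contra h
        have h1 := hcond.resolve_left h
        rw [Finset.not_nonempty_iff_eq_empty.1 h, Finset.card_empty] at hcard
        omega
      obtain ⟨x, hx⟩ := hNe
      exact hW.resolve_left (not_not.2 hc) (hd.of_erase hv
        (by rw [hWe]; simp [hx]) (hN x hx) hcl)
    · left; omega
  · rw [C.acyclic_congr (E := facets W (W.erase v))]
    · exact hfac
    · intro s l
      refine ⟨fun h => h.elim id fun h' => ?_, Or.inl⟩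
      cases s with
      | zero =>
        rw [C.eq_base l, C.shift_base]
        obtain ⟨q, hq⟩ := hQne
        exact ⟨q, by rw [← hU]; simp [hq], bot_le⟩
      | succ s =>
        exact absurd (isUpperSet_nonCliques h' (C.shift_mem isUpperSet_nonCliques s l)) hW'

/-- Same decomposition. If `v` is isolated, `Iio (W.erase v)` is exact in level `t` because its only
bad level is `t - 1`, so the obstruction of `not_acyclic_facets_isolated` survives in `Iio W`.
Otherwise `W.erase v` is still disconnected, and its obstruction survives through the connecting
map. -/
lemma not_acyclic_Iio_of_isDisconnectedOn (hG : IsChordal G) :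
    ∀ (W : Finset σ) (t : ℕ), t + 2 = W.card → IsDisconnectedOn G W →
      ¬ C.Acyclic t (Set.Iio W) := by
  intro W
  induction W using Finset.strongInduction with
  | H W ih =>
  intro t ht hW hac
  have hWn := hW.mem_nonCliques
  obtain ⟨v, hv, hcl⟩ := hG W (by obtain ⟨x, hx, _⟩ := hWn; exact ⟨x, hx⟩)
  obtain ⟨N, Q, hvN, hvQ, hNQ, hN, hQ, hNc, hU⟩ := exists_neighbors_split hv hcl
  have hWe : W = insert v (N ∪ Q) := by rw [hU, Finset.insert_erase hv]
  have hQne : Q.Nonempty := by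
    by_contra h
    rw [Finset.not_nonempty_iff_eq_empty] at h
    rw [hWe, h, Finset.union_empty] at hWn
    exact hNc hWn
  have hcard : W.card = N.card + Q.card + 1 := by
    rw [hWe, Finset.card_insert_of_notMem (by simp [hvN, hvQ]), Finset.card_union_of_disjoint hNQ]
  cases t with
  | zero =>
    refine C.not_acyclic_zero ?_ ?_ hac
    · exact bot_lt_iff_ne_bot.2 (Finset.ne_empty_of_mem hv)
    · rintro b hb ⟨x, hx, y, hy, hxy, _⟩
      have h1 := Finset.card_lt_card (show b ⊂ W from hb)
      have h2 := Finset.one_lt_card.2 ⟨x, hx, y, hy, hxy⟩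
      omega
  | succ t =>
  rw [Iio_eq_facets_union hv] at hac
  rcases N.eq_empty_or_nonempty with rfl | ⟨x, hx⟩
  · simp only [Finset.card_empty, zero_add] at hcard
    refine C.not_acyclic_facets_isolated hQne (t + 1) hvQ hQ (by omega) ?_
    have := C.acyclic_left (isLowerSet_facets _ _) (isLowerSet_Iic _) hac (by
      rw [facets_erase_inter]
      refine C.acyclic_Iio hG _ _ (Or.inl (by simp)) (Or.inl ?_)
      rw [Finset.card_erase_of_mem hv]
      omega)
    rw [← hU, hWe] at this
    simpa using this
  · have hW' := hW.erase hv (by rw [hWe]; simp [hx]) (hN x hx)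
    refine ih _ (Finset.erase_ssubset hv) t (by rw [Finset.card_erase_of_mem hv]; omega) hW' ?_
    rw [← facets_erase_inter]
    refine C.acyclic_inter (isLowerSet_facets _ _) (isLowerSet_Iic _) ?_
      (C.acyclic_Iic (Or.inr hW'.mem_nonCliques)) hac
    rw [← hU, hWe]
    exact C.acyclic_facets_erase hQne hvN hNc t hvQ hNQ hQ (Or.inl ⟨x, hx⟩)

/-- The degrees in level `k + 1` are the disconnected sets of `k + 2` vertices. -/
theorem exists_shift_eq_iff (hG : IsChordal G) (k : ℕ) (W : Finset σ) :
    (∃ j, C.shift (k + 1) j = W) ↔ W.card = k + 2 ∧ IsDisconnectedOn G W := by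
  constructor
  · rintro ⟨j, rfl⟩
    by_contra h
    refine C.not_acyclic_Iio j (C.acyclic_Iio hG _ k
      (Or.inr (C.shift_mem isUpperSet_nonCliques k j)) ?_)
    rw [eq_comm] at h
    tauto
  · rintro ⟨hc, hW⟩
    exact C.exists_shift_eq (Or.inr hW.mem_nonCliques)
      (C.not_acyclic_Iio_of_isDisconnectedOn hG W k hc.symm hW)

end StrandComplex

/-! ### Multigraded maps and setting the variables to `1` -/

section GradedMap

variable {K : Type*} [Field K] {σ : Type*} {ι₁ ι₂ ι₃ : Type*}

/-- A map of free modules, whose bases have the degrees `s₁` and `s₂`, preserves multidegrees. -/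
def IsMultihomogeneous (s₁ : ι₁ → σ →₀ ℕ) (s₂ : ι₂ → σ →₀ ℕ)
    (f : (ι₁ →₀ MvPolynomial σ K) →ₗ[MvPolynomial σ K] (ι₂ →₀ MvPolynomial σ K)) : Prop :=
  ∀ j l, ∀ e ∈ (f (Finsupp.single j 1) l).support, s₂ l + e = s₁ j

open Classical in
/-- The coefficients of the component of degree `b`. -/
def degreePart (s : ι₁ → σ →₀ ℕ) (b : σ →₀ ℕ) :
    (ι₁ →₀ MvPolynomial σ K) →ₗ[K] (ι₁ →₀ K) where
  toFun y := Finsupp.onFinset y.support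
    (fun l => if s l ≤ b then coeff (b - s l) (y l) else 0) (fun l h => by
      rw [Finsupp.mem_support_iff]; rintro h'; simp [h'] at h)
  map_add' x y := by
    ext l
    simp only [Finsupp.onFinset_apply, Finsupp.add_apply]
    split_ifs <;> simp
  map_smul' c y := by
    ext l
    simp only [Finsupp.onFinset_apply, Finsupp.smul_apply]
    split_ifs <;> simp

open Classical in
/-- The element of degree `b` with given coefficients. -/
def homogenize (s : ι₁ → σ →₀ ℕ) (b : σ →₀ ℕ) :
    (ι₁ →₀ K) →ₗ[K] (ι₁ →₀ MvPolynomial σ K) where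
  toFun z := Finsupp.onFinset z.support
    (fun l => if s l ≤ b then monomial (b - s l) (z l) else 0) (fun l h => by
      rw [Finsupp.mem_support_iff]; rintro h'; simp [h'] at h)
  map_add' x y := by
    ext1 l
    simp only [Finsupp.onFinset_apply, Finsupp.add_apply]
    split_ifs <;> simp
  map_smul' c y := by
    ext1 l
    simp only [Finsupp.onFinset_apply, Finsupp.smul_apply, RingHom.id_apply]
    split_ifs <;> simp [smul_monomial]

/-- Setting all variables to `1`. -/
def dehomogenize : (ι₁ →₀ MvPolynomial σ K) →ₗ[K] (ι₁ →₀ K) :=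
  Finsupp.mapRange.linearMap (aeval (fun _ => (1 : K))).toLinearMap

/-- The map induced by `f` after setting all variables to `1`. -/
def strandMap (f : (ι₁ →₀ MvPolynomial σ K) →ₗ[MvPolynomial σ K] (ι₂ →₀ MvPolynomial σ K)) :
    (ι₁ →₀ K) →ₗ[K] (ι₂ →₀ K) :=
  Finsupp.linearCombination K fun j => dehomogenize (f (Finsupp.single j 1))

open Classical in
lemma degreePart_apply (s : ι₁ → σ →₀ ℕ) (b : σ →₀ ℕ) (y : ι₁ →₀ MvPolynomial σ K) (l : ι₁) :
    degreePart s b y l = if s l ≤ b then coeff (b - s l) (y l) else 0 := rfl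

open Classical in
lemma homogenize_apply (s : ι₁ → σ →₀ ℕ) (b : σ →₀ ℕ) (z : ι₁ →₀ K) (l : ι₁) :
    homogenize s b z l = if s l ≤ b then monomial (b - s l) (z l) else 0 := rfl

lemma dehomogenize_apply (y : ι₁ →₀ MvPolynomial σ K) (l : ι₁) :
    dehomogenize y l = aeval (fun _ => (1 : K)) (y l) := rfl

@[simp]
lemma strandMap_single
    (f : (ι₁ →₀ MvPolynomial σ K) →ₗ[MvPolynomial σ K] (ι₂ →₀ MvPolynomial σ K)) (j : ι₁) (c : K) :
    strandMap f (Finsupp.single j c) = c • dehomogenize (f (Finsupp.single j 1)) := by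
  simp [strandMap]

lemma map_single_eq_smul {R M : Type*} [CommSemiring R] [AddCommMonoid M] [Module R M]
    (f : (ι₁ →₀ R) →ₗ[R] M) (j : ι₁) (p : R) :
    f (Finsupp.single j p) = p • f (Finsupp.single j 1) := by
  rw [← map_smul, Finsupp.smul_single, smul_eq_mul, mul_one]

lemma degreePart_homogenize (s : ι₁ → σ →₀ ℕ) (b : σ →₀ ℕ) {z : ι₁ →₀ K}
    (hz : z ∈ Finsupp.supported K K (s ⁻¹' Set.Iic b)) : degreePart s b (homogenize s b z) = z := by
  ext l
  rw [degreePart_apply, homogenize_apply]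
  split_ifs with h
  · classical rw [coeff_monomial, if_pos rfl]
  · by_contra hne
    exact h (hz (Finsupp.mem_support_iff.2 (Ne.symm hne)))

lemma degreePart_mem (s : ι₁ → σ →₀ ℕ) (b : σ →₀ ℕ) (y : ι₁ →₀ MvPolynomial σ K) :
    degreePart s b y ∈ Finsupp.supported K K (s ⁻¹' Set.Iic b) := by
  intro l hl
  by_contra h
  rw [Finset.mem_coe, Finsupp.mem_support_iff, degreePart_apply] at hl
  exact hl (if_neg h)

lemma dehomogenize_smul (p : MvPolynomial σ K) (y : ι₁ →₀ MvPolynomial σ K) :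
    dehomogenize (p • y) = (aeval (fun _ => (1 : K)) p : K) • dehomogenize y := by
  ext l
  rw [dehomogenize_apply, Finsupp.smul_apply, smul_eq_mul, map_mul]
  rfl

lemma dehomogenize_map
    (f : (ι₁ →₀ MvPolynomial σ K) →ₗ[MvPolynomial σ K] (ι₂ →₀ MvPolynomial σ K))
    (y : ι₁ →₀ MvPolynomial σ K) : dehomogenize (f y) = strandMap f (dehomogenize y) := by
  induction y using Finsupp.induction_linear with
  | zero => simp
  | add x y hx hy => simp [hx, hy]
  | single j p =>
    rw [map_single_eq_smul, dehomogenize_smul]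
    have : dehomogenize (Finsupp.single j p) =
        Finsupp.single j (aeval (fun _ => (1 : K)) p : K) :=
      Finsupp.mapRange_single (hf := map_zero _)
    rw [this, strandMap_single]

lemma strandMap_comp_eq_zero
    {f : (ι₁ →₀ MvPolynomial σ K) →ₗ[MvPolynomial σ K] (ι₂ →₀ MvPolynomial σ K)}
    {g : (ι₂ →₀ MvPolynomial σ K) →ₗ[MvPolynomial σ K] (ι₃ →₀ MvPolynomial σ K)}
    (h : ∀ y, g (f y) = 0) (z : ι₁ →₀ K) : strandMap g (strandMap f z) = 0 := by
  have hz : dehomogenize (Finsupp.mapRange (C : K → MvPolynomial σ K) (map_zero _) z) = z := by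
    ext l
    exact aeval_C _ _
  rw [← hz, ← dehomogenize_map, ← dehomogenize_map, h, map_zero]

namespace IsMultihomogeneous

variable {s₁ : ι₁ → σ →₀ ℕ} {s₂ : ι₂ → σ →₀ ℕ}
  {f : (ι₁ →₀ MvPolynomial σ K) →ₗ[MvPolynomial σ K] (ι₂ →₀ MvPolynomial σ K)}

/-- Homogeneity leaves room for a single exponent, so the matrix entries are determined by the
scalars of `strandMap`. -/
lemma apply_eq_monomial (hf : IsMultihomogeneous s₁ s₂ f) (j : ι₁) (l : ι₂) :
    f (Finsupp.single j 1) l = monomial (s₁ j - s₂ l) (strandMap f (Finsupp.single j 1) l) := by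
  rw [strandMap_single, one_smul, dehomogenize_apply]
  have h : ∀ e ∈ (f (Finsupp.single j 1) l).support, e = s₁ j - s₂ l := fun e he => by
    rw [← hf j l e he, add_tsub_cancel_left]
  have h2 : f (Finsupp.single j 1) l =
      monomial (s₁ j - s₂ l) (coeff (s₁ j - s₂ l) (f (Finsupp.single j 1) l)) := by
    classical
    ext e
    rw [coeff_monomial]
    split_ifs with he
    · rw [he]
    · by_contra hne
      exact he (h e (mem_support_iff.2 hne)).symm
  rw [h2]
  simp [aeval_monomial]

lemma le_of_ne_zero (hf : IsMultihomogeneous s₁ s₂ f) {j : ι₁} {l : ι₂}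
    (h : strandMap f (Finsupp.single j 1) l ≠ 0) : s₂ l ≤ s₁ j := by
  classical
  rw [← hf j l (s₁ j - s₂ l)]
  · exact le_self_add
  · rw [mem_support_iff, hf.apply_eq_monomial, coeff_monomial, if_pos rfl]
    exact h

/-- With `map_homogenize`, this identifies the degree `b` component of the module map with
`strandMap` on the basis elements of degree at most `b`; exactness transfers in this way. -/
lemma degreePart_map (hf : IsMultihomogeneous s₁ s₂ f) (b : σ →₀ ℕ)
    (y : ι₁ →₀ MvPolynomial σ K) :
    degreePart s₂ b (f y) = strandMap f (degreePart s₁ b y) := by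
  classical
  induction y using Finsupp.induction_linear with
  | zero => simp
  | add x y hx hy => simp [hx, hy]
  | single j p =>
  induction p using MvPolynomial.induction_on' with
  | add p q hp hq => rw [Finsupp.single_add, map_add, map_add, map_add, map_add, hp, hq]
  | monomial e c =>
  have h1 : degreePart s₁ b (Finsupp.single j (monomial e c)) =
      if s₁ j + e = b then Finsupp.single j c else 0 := by
    ext l
    rw [degreePart_apply]
    by_cases hl : j = l
    · subst hl
      rw [Finsupp.single_eq_same, coeff_monomial]
      by_cases he : s₁ j + e = b
      · have : s₁ j ≤ b := he ▸ le_self_add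
        rw [if_pos he, if_pos this, if_pos, Finsupp.single_eq_same]
        rw [← he, add_tsub_cancel_left]
      · rw [if_neg he]
        split_ifs with h2 h3
        · exact absurd (by rw [h3, add_tsub_cancel_of_le h2]) he
        · rfl
        · rfl
    · have : Finsupp.single j (monomial e c) l = 0 := by simp [hl]
      rw [this]
      split_ifs <;> simp [hl]
  rw [h1, map_single_eq_smul]
  ext l
  rw [degreePart_apply, Finsupp.smul_apply, hf.apply_eq_monomial, smul_eq_mul, monomial_mul,
    coeff_monomial]
  by_cases h0 : strandMap f (Finsupp.single j 1) l = 0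
  · rw [h0, mul_zero, ite_self, ite_self]
    split_ifs
    · rw [strandMap_single, one_smul] at h0
      rw [strandMap_single, Finsupp.smul_apply, h0, smul_zero]
    · simp
  · have hle := hf.le_of_ne_zero h0
    by_cases he : s₁ j + e = b
    · have h2 : s₂ l ≤ b := hle.trans (he ▸ le_self_add)
      rw [if_pos he, if_pos h2, if_pos, strandMap_single _ j c, strandMap_single, one_smul,
        Finsupp.smul_apply, smul_eq_mul]
      rw [← he, add_comm, add_comm (s₁ j) e, add_comm _ e, add_tsub_assoc_of_le hle]
    · rw [if_neg he]
      simp only [map_zero, Finsupp.zero_apply]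
      split_ifs with h2 h3
      · refine absurd ?_ he
        rw [← add_tsub_cancel_of_le h2, ← h3, add_left_comm, add_tsub_cancel_of_le hle, add_comm]
      · rfl
      · rfl

lemma map_homogenize (hf : IsMultihomogeneous s₁ s₂ f) (b : σ →₀ ℕ) {z : ι₁ →₀ K}
    (hz : z ∈ Finsupp.supported K K (s₁ ⁻¹' Set.Iic b)) :
    f (homogenize s₁ b z) = homogenize s₂ b (strandMap f z) := by
  rw [Finsupp.supported_eq_span_single] at hz
  induction hz using Submodule.span_induction with
  | zero => simp
  | add x y _ _ hx hy => simp [hx, hy]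
  | smul c x _ hx =>
    rw [map_smul (homogenize s₁ b), map_smul (strandMap f), map_smul (homogenize s₂ b), ← hx,
      ← algebraMap_smul (MvPolynomial σ K) c (homogenize s₁ b x),
      LinearMap.map_smul f, algebraMap_smul]
  | mem x hx =>
    obtain ⟨j, hj, rfl⟩ := hx
    have hj' : s₁ j ≤ b := hj
    have h1 : homogenize s₁ b (Finsupp.single j (1 : K)) =
        Finsupp.single j (monomial (b - s₁ j) 1) := by
      classical
      ext1 l
      rw [homogenize_apply]
      by_cases hl : j = l
      · subst hl
        simp [hj']
      · simp [hl]
    rw [h1, map_single_eq_smul]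
    ext1 l
    rw [homogenize_apply, Finsupp.smul_apply, hf.apply_eq_monomial, smul_eq_mul, monomial_mul,
      one_mul]
    by_cases h0 : strandMap f (Finsupp.single j 1) l = 0
    · rw [h0, map_zero, map_zero, ite_self]
    · have hle := hf.le_of_ne_zero h0
      rw [if_pos (hle.trans hj')]
      congr 1
      rw [← add_tsub_assoc_of_le hle, tsub_add_cancel_of_le hj']

end IsMultihomogeneous

end GradedMap

/-! ### From a minimal resolution to squarefree strands -/

section Resolution

variable {K : Type*} [Field K] {σ : Type*} {I : Ideal (MvPolynomial σ K)}

lemma coeff_zero_of_mem_smul_top {ι : Type*} {y : ι →₀ MvPolynomial σ K}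
    (hy : y ∈ (Ideal.span (Set.range (X : σ → MvPolynomial σ K))) •
      (⊤ : Submodule (MvPolynomial σ K) (ι →₀ MvPolynomial σ K))) (l : ι) :
    coeff 0 (y l) = 0 := by
  have hX : Ideal.span (Set.range (X : σ → MvPolynomial σ K)) ≤ RingHom.ker constantCoeff := by
    rw [Ideal.span_le]
    rintro _ ⟨v, rfl⟩
    simp [RingHom.mem_ker]
  induction hy using Submodule.smul_induction_on' with
  | smul r hr n _ =>
    rw [Finsupp.smul_apply, smul_eq_mul, ← constantCoeff_eq, map_mul,
      (RingHom.mem_ker).1 (hX hr), zero_mul]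
  | add x _ y _ hx hy => rw [Finsupp.add_apply, coeff_add, hx, hy, add_zero]

namespace MinimalMultigradedResolution

variable (F : MinimalMultigradedResolution I)

/-- The bases of the resolution of `S / I`. -/
def augBasis : ℕ → Type
  | 0 => Unit
  | t + 1 => F.ι t

/-- The degrees of the bases of the resolution of `S / I`. -/
def augShift : ∀ t, F.augBasis t → (σ →₀ ℕ)
  | 0, _ => 0
  | t + 1, j => F.shift t j

/-- The differentials of the resolution of `S / I`. -/
def augD : ∀ t, (F.augBasis (t + 1) →₀ MvPolynomial σ K) →ₗ[MvPolynomial σ K]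
    (F.augBasis t →₀ MvPolynomial σ K)
  | 0 => (Finsupp.lsingle () : _ →ₗ[MvPolynomial σ K] (Unit →₀ MvPolynomial σ K)) ∘ₗ F.aug
  | t + 1 => F.d t

lemma augD_zero_apply (y : F.ι 0 →₀ MvPolynomial σ K) : F.augD 0 y () = F.aug y :=
  Finsupp.single_eq_same

lemma aug_mem (y : F.ι 0 →₀ MvPolynomial σ K) : F.aug y ∈ I :=
  F.range_aug.le ⟨y, rfl⟩

lemma augD_homogeneous : ∀ t, IsMultihomogeneous (F.augShift (t + 1)) (F.augShift t) (F.augD t)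
  | 0 => fun j l e he => by
    cases l
    exact (zero_add e).trans (F.aug_homogeneous j e
      ((congrArg (fun p => e ∈ MvPolynomial.support p) (F.augD_zero_apply _)).mp he))
  | t + 1 => F.d_homogeneous t

lemma augD_exact : ∀ t, Function.Exact (F.augD (t + 1)) (F.augD t)
  | 0 => fun y => by
    refine Iff.trans ?_ (F.exact_zero y)
    have h := F.augD_zero_apply y
    exact ⟨fun h' => h.symm.trans (DFunLike.congr_fun h' ()),
      fun h' => Finsupp.ext fun _ => h.trans h'⟩
  | t + 1 => F.exact_succ t

/-- Equal degrees would make the matrix entry a nonzero constant: against minimality in positive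
levels, and a unit in `I` in level `0`. -/
lemma augShift_lt (hI : I ≠ ⊤) : ∀ t j l, strandMap (F.augD t) (Finsupp.single j 1) l ≠ 0 →
    F.augShift t l < F.augShift (t + 1) j := by
  intro t j l h
  refine lt_of_le_of_ne ((F.augD_homogeneous t).le_of_ne_zero h) fun e => h ?_
  have h1 := (F.augD_homogeneous t).apply_eq_monomial j l
  rw [e, tsub_self] at h1
  cases t with
  | zero =>
    cases l
    by_contra h
    refine hI (Ideal.eq_top_of_isUnit_mem I (F.aug_mem (Finsupp.single j 1)) ?_)
    · rw [← augD_zero_apply]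
      refine Eq.subst h1.symm (motive := IsUnit) ?_
      exact (Ne.isUnit h).map (C : K →+* MvPolynomial σ K)
  | succ t =>
    have h2 := coeff_zero_of_mem_smul_top (F.minimal t ⟨_, rfl⟩ :
      F.d t (Finsupp.single j 1) ∈ _) l
    change coeff 0 (F.augD (t + 1) (Finsupp.single j 1) l) = 0 at h2
    classical
    rwa [h1, coeff_monomial, if_pos rfl] at h2

/-- The strands of a minimal resolution of `S / I`. -/
def toStrandComplex (hI : I ≠ ⊤) :
    StrandComplex K (σ →₀ ℕ) {b | monomial b (1 : K) ∈ I} where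
  ι := F.augBasis
  shift := F.augShift
  base := ()
  eq_base _ := rfl
  shift_base := rfl
  δ t := strandMap (F.augD t)
  shift_lt := F.augShift_lt hI
  δ_δ t := strandMap_comp_eq_zero fun y => (F.augD_exact t).apply_apply_eq_zero y
  exact_Iic b t z hz hc := by
    have h := (F.augD_homogeneous t).map_homogenize b hz
    rw [hc, map_zero] at h
    obtain ⟨y, hy⟩ := (F.augD_exact t _).1 h
    refine ⟨degreePart _ b y, degreePart_mem _ b y, ?_⟩
    rw [← (F.augD_homogeneous (t + 1)).degreePart_map, hy, degreePart_homogenize _ b hz]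
  exact_base b hb := by
    have hb' : monomial b (1 : K) ∈ LinearMap.range F.aug := by rw [F.range_aug]; exact hb
    obtain ⟨y, hy⟩ := hb'
    refine ⟨degreePart _ b y, degreePart_mem _ b y, ?_⟩
    refine ((F.augD_homogeneous 0).degreePart_map b y).symm.trans (Finsupp.ext fun l => ?_)
    rw [degreePart_apply]
    change (if (0 : σ →₀ ℕ) ≤ b then coeff (b - 0) (F.augD 0 y ()) else 0) = _
    classical
    rw [augD_zero_apply, hy, if_pos (zero_le), tsub_zero, coeff_monomial, if_pos rfl]
    exact Finsupp.single_eq_same.symm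
  mem_of_δ_base j h := by
    have h1 := (F.augD_homogeneous 0).apply_eq_monomial j ()
    have h3 : F.augD 0 (Finsupp.single j 1) () ∈ I :=
      (congrArg (· ∈ I) (F.augD_zero_apply _)).mpr (F.aug_mem _)
    rw [h1] at h3
    have h4 := I.mul_mem_left (C (strandMap (F.augD 0) (Finsupp.single j 1) ())⁻¹) h3
    rw [C_mul_monomial, inv_mul_cancel₀ h] at h4
    simpa [augShift] using h4

end MinimalMultigradedResolution

/-- The exponent of the squarefree monomial with support `W`. -/
def sqfreeExp (W : Finset σ) : σ →₀ ℕ := Finsupp.indicator W fun _ _ => 1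

open Classical in
lemma sqfreeExp_apply (W : Finset σ) (v : σ) : sqfreeExp W v = if v ∈ W then 1 else 0 := by
  simp [sqfreeExp, Finsupp.indicator_apply]

@[simp]
lemma support_sqfreeExp (W : Finset σ) : (sqfreeExp W).support = W := by
  ext v
  simp [sqfreeExp_apply]

lemma sqfreeExp_le_iff {W : Finset σ} {b : σ →₀ ℕ} : sqfreeExp W ≤ b ↔ W ⊆ b.support := by
  constructor
  · intro h v hv
    have := h v
    rw [sqfreeExp_apply, if_pos hv] at this
    simp
    omega
  · intro h v
    rw [sqfreeExp_apply]
    split_ifs with hv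
    · have := h hv
      simp at this
      omega
    · exact zero_le

lemma sqfreeExp_injective : Function.Injective (sqfreeExp : Finset σ → σ →₀ ℕ) := fun W W' h => by
  rw [← support_sqfreeExp W, h, support_sqfreeExp]

namespace StrandComplex

variable {J : Set (σ →₀ ℕ)} {J' : Set (Finset σ)}

/-- By induction on the level, the boundary of a basis element lives in squarefree degrees, hence
below the squarefree part of its own degree. That part is still in `J`, so the strand below it is
exact, and a larger degree would contradict minimality. -/
lemma shift_eq_sqfreeExp (C : StrandComplex K (σ →₀ ℕ) J) (hJ : ∀ b, b ∈ J ↔ b.support ∈ J')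
    (hup : IsUpperSet J') : ∀ t l, C.shift t l = sqfreeExp (C.shift t l).support
  | 0, l => by
    rw [C.eq_base l, C.shift_base]
    ext v
    rw [sqfreeExp_apply, if_neg (by rw [Finsupp.mem_support_iff, not_not]; rfl)]
    rfl
  | t + 1, j => by
    by_contra hne
    have hle : sqfreeExp (C.shift (t + 1) j).support ≤ C.shift (t + 1) j :=
      sqfreeExp_le_iff.2 le_rfl
    have hJu : IsUpperSet J := fun a b hab ha =>
      (hJ b).2 (hup (Finsupp.support_mono hab) ((hJ a).1 ha))
    refine C.not_acyclic_of_δ_mem j (D := Set.Iic (sqfreeExp (C.shift (t + 1) j).support))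
      (fun h => hne (le_antisymm h hle)) (Set.Iic_subset_Iic.2 hle) ?_ (C.acyclic_Iic (Or.inr ?_))
    · intro l hl
      have h1 := C.shift_lt t j l (Finsupp.mem_support_iff.1 hl)
      rw [Set.mem_preimage, Set.mem_Iic, C.shift_eq_sqfreeExp hJ hup t l, sqfreeExp_le_iff,
        support_sqfreeExp]
      exact Finsupp.support_mono h1.le
    · rw [hJ, support_sqfreeExp, ← hJ]
      exact C.shift_mem hJu t j

/-- When membership in `J` depends on the support only, all degrees are squarefree and are
replaced by their supports. -/
def toFinset (C : StrandComplex K (σ →₀ ℕ) J) (hJ : ∀ b, b ∈ J ↔ b.support ∈ J')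
    (hup : IsUpperSet J') : StrandComplex K (Finset σ) J' where
  ι := C.ι
  shift t l := (C.shift t l).support
  base := C.base
  eq_base := C.eq_base
  shift_base := by rw [C.shift_base]; rfl
  δ := C.δ
  shift_lt t j l h := by
    have h1 := C.shift_lt t j l h
    refine lt_of_le_of_ne (Finsupp.support_mono h1.le) fun e => ?_
    rw [C.shift_eq_sqfreeExp hJ hup, e, ← C.shift_eq_sqfreeExp hJ hup] at h1
    exact lt_irrefl _ h1
  δ_δ := C.δ_δ
  exact_Iic W t z hz hc := by
    have key : ∀ t, (fun l => (C.shift t l).support) ⁻¹' Set.Iic W =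
        C.shift t ⁻¹' Set.Iic (sqfreeExp W) := fun t => by
      ext l
      rw [Set.mem_preimage, Set.mem_preimage, Set.mem_Iic, Set.mem_Iic,
        C.shift_eq_sqfreeExp hJ hup t l, sqfreeExp_le_iff, support_sqfreeExp, support_sqfreeExp]
    rw [key] at hz ⊢
    exact C.exact_Iic _ t z hz hc
  exact_base W hW := by
    have key : ∀ t, (fun l => (C.shift t l).support) ⁻¹' Set.Iic W =
        C.shift t ⁻¹' Set.Iic (sqfreeExp W) := fun t => by
      ext l
      rw [Set.mem_preimage, Set.mem_preimage, Set.mem_Iic, Set.mem_Iic,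
        C.shift_eq_sqfreeExp hJ hup t l, sqfreeExp_le_iff, support_sqfreeExp, support_sqfreeExp]
    rw [key]
    exact C.exact_base _ ((hJ _).2 (by rwa [support_sqfreeExp]))
  mem_of_δ_base j h := (hJ _).1 (C.mem_of_δ_base j h)

end StrandComplex

lemma edgeIdeal_eq_span_monomial (G : SimpleGraph σ) :
    edgeIdeal K G = Ideal.span ((fun s => monomial s (1 : K)) ''
      {s | ∃ u v, G.Adj u v ∧ s = Finsupp.single u 1 + Finsupp.single v 1}) := by
  rw [edgeIdeal]
  congr 1
  ext p
  simp only [Set.mem_ofPred_eq, Set.mem_image]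
  constructor
  · rintro ⟨u, v, h, rfl⟩
    exact ⟨_, ⟨u, v, h, rfl⟩, by simp [X, monomial_mul]⟩
  · rintro ⟨_, ⟨u, v, h, rfl⟩, rfl⟩
    exact ⟨u, v, h, by simp [X, monomial_mul]⟩

lemma monomial_mem_edgeIdeal_compl (G : SimpleGraph σ) (b : σ →₀ ℕ) :
    monomial b (1 : K) ∈ edgeIdeal K Gᶜ ↔ b.support ∈ nonCliques G := by
  classical
  rw [edgeIdeal_eq_span_monomial, mem_ideal_span_monomial_image]
  simp only [support_monomial, one_ne_zero, if_false, Finset.mem_singleton, forall_eq,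
    Set.mem_ofPred_eq, nonCliques]
  constructor
  · rintro ⟨_, ⟨u, v, h, rfl⟩, hb⟩
    have hne := h.ne
    have h1 := hb u
    have h2 := hb v
    simp only [Finsupp.add_apply, Finsupp.single_eq_same] at h1 h2
    exact ⟨u, by simp; omega, v, by simp; omega, hne, ((SimpleGraph.compl_adj _ _ _).1 h).2⟩
  · rintro ⟨x, hx, y, hy, hne, h⟩
    refine ⟨_, ⟨x, y, (SimpleGraph.compl_adj _ _ _).2 ⟨hne, h⟩, rfl⟩, fun w => ?_⟩
    simp only [Finsupp.mem_support_iff] at hx hy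
    simp only [Finsupp.add_apply, Finsupp.single_apply]
    split_ifs with h1 h2 h2
    · exact absurd (h1.trans h2.symm) hne
    · subst h1; omega
    · subst h2; omega
    · omega

lemma edgeIdeal_compl_ne_top (G : SimpleGraph σ) : edgeIdeal K Gᶜ ≠ ⊤ := by
  intro h
  have := (monomial_mem_edgeIdeal_compl (K := K) G 0).1 (h ▸ Submodule.mem_top)
  obtain ⟨x, hx, _⟩ := this
  simp at hx

/-- The multidegrees in a minimal resolution of the edge ideal of the complement of a chordal
graph. -/
theorem MinimalMultigradedResolution.exists_shift_eq_iff [DecidableEq σ] {G : SimpleGraph σ}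
    (hG : IsChordal G) (F : MinimalMultigradedResolution (edgeIdeal K Gᶜ)) (k : ℕ) (a : σ →₀ ℕ) :
    (∃ j, F.shift k j = a) ↔ ∃ W : Finset σ, W.card = k + 2 ∧ IsDisconnectedOn G W ∧
      a = sqfreeExp W := by
  set C := F.toStrandComplex (edgeIdeal_compl_ne_top G)
  have hJ := monomial_mem_edgeIdeal_compl (K := K) G
  have h1 := C.shift_eq_sqfreeExp hJ isUpperSet_nonCliques (k + 1)
  have h2 := (C.toFinset hJ isUpperSet_nonCliques).exists_shift_eq_iff hG k
  constructor
  · rintro ⟨j, rfl⟩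
    obtain ⟨h3, h4⟩ := (h2 (F.shift k j).support).1 ⟨j, rfl⟩
    exact ⟨_, h3, h4, h1 j⟩
  · rintro ⟨W, hc, hW, rfl⟩
    obtain ⟨j, hj⟩ := (h2 W).2 ⟨hc, hW⟩
    refine ⟨j, ?_⟩
    rw [← hj]
    exact h1 j

end Resolution

/-! ### Existence of minimal multigraded resolutions -/

section Existence

variable {K : Type*} [Field K] {σ : Type*}

/-- A submodule of a multigraded free module that contains the homogeneous components of its
elements. -/
def IsMultigraded {ι : Type*} (s : ι → σ →₀ ℕ)
    (N : Submodule (MvPolynomial σ K) (ι →₀ MvPolynomial σ K)) : Prop :=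
  ∀ y ∈ N, ∀ b, homogenize s b (degreePart s b y) ∈ N

/-- All terms of `y` have degree `b`. -/
def HasMultidegree {ι : Type*} (s : ι → σ →₀ ℕ) (b : σ →₀ ℕ)
    (y : ι →₀ MvPolynomial σ K) : Prop :=
  ∀ l, ∀ e ∈ (y l).support, s l + e = b

open Classical in
lemma coeff_homogenize_degreePart {ι : Type*} (s : ι → σ →₀ ℕ) (b e : σ →₀ ℕ)
    (y : ι →₀ MvPolynomial σ K) (l : ι) :
    coeff e (homogenize s b (degreePart s b y) l) = if s l + e = b then coeff e (y l) else 0 := by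
  rw [homogenize_apply, degreePart_apply]
  split_ifs with h1 h2 h2
  · rw [coeff_monomial, ← h2, add_tsub_cancel_left, if_pos rfl]
  · rw [coeff_monomial, if_neg]
    intro h
    rw [← h, add_tsub_cancel_of_le h1] at h2
    exact h2 rfl
  · exact absurd (h2 ▸ le_self_add) h1
  · simp

lemma hasMultidegree_homogenize {ι : Type*} (s : ι → σ →₀ ℕ) (b : σ →₀ ℕ)
    (y : ι →₀ MvPolynomial σ K) :
    HasMultidegree s b (homogenize s b (degreePart s b y)) := by
  classical
  intro l e he
  rw [mem_support_iff, coeff_homogenize_degreePart] at he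
  by_contra h
  exact he (if_neg h)

lemma exists_eq_sum_homogenize {ι : Type*} (s : ι → σ →₀ ℕ) (y : ι →₀ MvPolynomial σ K) :
    ∃ B : Finset (σ →₀ ℕ), y = ∑ b ∈ B, homogenize s b (degreePart s b y) := by
  classical
  refine ⟨y.support.biUnion fun l => (y l).support.image fun e => s l + e, ?_⟩
  ext l e
  rw [Finsupp.finsetSum_apply, coeff_sum]
  simp only [coeff_homogenize_degreePart, Finset.sum_ite_eq]
  split_ifs with h
  · rfl
  · by_contra hne
    refine h (Finset.mem_biUnion.2 ⟨l, ?_, Finset.mem_image.2 ⟨e, mem_support_iff.2 hne, rfl⟩⟩)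
    rw [Finsupp.mem_support_iff]
    rintro h0
    simp [h0] at hne

lemma mem_smul_top_of_coeff_zero {ι : Type*} [Finite ι] {y : ι →₀ MvPolynomial σ K}
    (hy : ∀ l, coeff 0 (y l) = 0) :
    y ∈ (Ideal.span (Set.range (X : σ → MvPolynomial σ K))) •
      (⊤ : Submodule (MvPolynomial σ K) (ι →₀ MvPolynomial σ K)) := by
  classical
  rw [← Finsupp.sum_single y]
  refine Submodule.sum_mem _ fun l _ => ?_
  have h : y l ∈ Ideal.span (Set.range (X : σ → MvPolynomial σ K)) := by
    rw [← Set.image_univ, mem_ideal_span_X_image]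
    intro e he
    by_contra! h
    have : e = 0 := Finsupp.ext fun v => h v trivial
    rw [mem_support_iff, this] at he
    exact he (hy l)
  have := Submodule.smul_mem_smul h (Submodule.mem_top :
    (Finsupp.single l 1 : ι →₀ MvPolynomial σ K) ∈ ⊤)
  simpa using this

lemma IsMultihomogeneous.map_homogenize_degreePart {ι₁ ι₂ : Type*} {s₁ : ι₁ → σ →₀ ℕ}
    {s₂ : ι₂ → σ →₀ ℕ}
    {f : (ι₁ →₀ MvPolynomial σ K) →ₗ[MvPolynomial σ K] (ι₂ →₀ MvPolynomial σ K)}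
    (hf : IsMultihomogeneous s₁ s₂ f) (b : σ →₀ ℕ) (y : ι₁ →₀ MvPolynomial σ K) :
    f (homogenize s₁ b (degreePart s₁ b y)) = homogenize s₂ b (degreePart s₂ b (f y)) := by
  rw [hf.map_homogenize b (degreePart_mem _ b y), hf.degreePart_map]

lemma IsMultihomogeneous.isMultigraded_ker {ι₁ ι₂ : Type*} {s₁ : ι₁ → σ →₀ ℕ}
    {s₂ : ι₂ → σ →₀ ℕ}
    {f : (ι₁ →₀ MvPolynomial σ K) →ₗ[MvPolynomial σ K] (ι₂ →₀ MvPolynomial σ K)}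
    (hf : IsMultihomogeneous s₁ s₂ f) : IsMultigraded s₁ (LinearMap.ker f) := by
  intro y hy b
  rw [LinearMap.mem_ker] at *
  rw [hf.map_homogenize_degreePart, hy, map_zero, map_zero]

lemma exists_homogeneous_generators [Finite σ] {ι : Type*} [Finite ι] {s : ι → σ →₀ ℕ}
    {N : Submodule (MvPolynomial σ K) (ι →₀ MvPolynomial σ K)} (hN : IsMultigraded s N) :
    ∃ (m : ℕ) (g : Fin m → ι →₀ MvPolynomial σ K),
      (∀ i, ∃ b, HasMultidegree s b (g i)) ∧ Submodule.span _ (Set.range g) = N := by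
  classical
  set H : Set (ι →₀ MvPolynomial σ K) := {y | y ∈ N ∧ ∃ b, HasMultidegree s b y} with hH
  have hspan : Submodule.span (MvPolynomial σ K) H = N := by
    refine le_antisymm (Submodule.span_le.2 fun y hy => hy.1) fun y hy => ?_
    obtain ⟨B, hB⟩ := exists_eq_sum_homogenize s y
    rw [hB]
    exact Submodule.sum_mem _ fun b _ =>
      Submodule.subset_span ⟨hN y hy b, b, hasMultidegree_homogenize s b y⟩
  have hfg : (Submodule.span (MvPolynomial σ K) H).FG := IsNoetherian.noetherian _
  obtain ⟨T, hT, hT'⟩ := (Submodule.fg_span_iff_fg_span_finset_subset H).1 hfg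
  refine ⟨T.card, fun i => T.equivFin.symm i, fun i => (hT (T.equivFin.symm i).2).2, ?_⟩
  rw [← hspan, hT']
  congr 1
  ext y
  constructor
  · rintro ⟨i, rfl⟩
    exact (T.equivFin.symm i).2
  · intro hy
    exact ⟨T.equivFin ⟨y, hy⟩, by simp⟩

/-- A multigraded submodule is the image of a minimal cover. -/
theorem exists_minimal_cover [Finite σ] {ι : Type*} [Finite ι] {s : ι → σ →₀ ℕ}
    {N : Submodule (MvPolynomial σ K) (ι →₀ MvPolynomial σ K)} (hN : IsMultigraded s N) :
    ∃ (m : ℕ) (s' : Fin m → σ →₀ ℕ)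
      (f : (Fin m →₀ MvPolynomial σ K) →ₗ[MvPolynomial σ K] (ι →₀ MvPolynomial σ K)),
      IsMultihomogeneous s' s f ∧ LinearMap.range f = N ∧
      LinearMap.ker f ≤ (Ideal.span (Set.range (X : σ → MvPolynomial σ K))) •
        (⊤ : Submodule (MvPolynomial σ K) (Fin m →₀ MvPolynomial σ K)) := by
  classical
  have hex := exists_homogeneous_generators hN
  -- The cover uses the least possible number of homogeneous generators; a relation with a nonzero
  -- constant coefficient would make one of them redundant.
  obtain ⟨g, hg, hspan⟩ := Nat.find_spec hex
  have hmin := fun k (hk : k < Nat.find hex) => Nat.find_min hex hk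
  generalize Nat.find hex = m at g hg hspan hmin
  choose s' hs' using hg
  have hf : IsMultihomogeneous s' s (Finsupp.linearCombination (MvPolynomial σ K) g) := by
    intro j l e he
    rw [Finsupp.linearCombination_single, one_smul] at he
    exact hs' j l e he
  refine ⟨m, s', Finsupp.linearCombination _ g, hf, ?_, ?_⟩
  · rw [Finsupp.range_linearCombination, hspan]
  intro c hc
  refine mem_smul_top_of_coeff_zero fun j => ?_
  by_contra hne
  obtain ⟨m, rfl⟩ := Nat.exists_eq_succ_of_ne_zero (Fin.pos j).ne'
  refine hmin m (Nat.lt_succ_self m) ⟨g ∘ j.succAbove, fun i => ⟨_, hs' _⟩, ?_⟩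
  -- In the component of degree `s' j` the coefficient of `g j` is exactly that constant, so the
  -- relation can be solved for `g j`.
  have hc' := hf.isMultigraded_ker c hc (s' j)
  set c' := homogenize s' (s' j) (degreePart s' (s' j) c) with hc'_def
  have hcj : c' j = C (coeff 0 (c j)) := by
    rw [hc'_def, homogenize_apply, degreePart_apply, if_pos le_rfl, tsub_self, if_pos le_rfl]
    rfl
  rw [LinearMap.mem_ker, Finsupp.linearCombination_apply, Finsupp.sum_fintype _ _ (by simp),
    Fin.sum_univ_succAbove _ j] at hc'
  have hgj : g j ∈ Submodule.span (MvPolynomial σ K) (Set.range (g ∘ j.succAbove)) := by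
    have h1 : g j = (C (coeff 0 (c j))⁻¹ : MvPolynomial σ K) • (c' j • g j) := by
      rw [hcj, smul_smul, ← C_mul, inv_mul_cancel₀ hne, C_1, one_smul]
    rw [h1, eq_neg_of_add_eq_zero_left hc']
    exact Submodule.smul_mem _ _ (neg_mem (Submodule.sum_mem _ fun i _ =>
      Submodule.smul_mem _ _ (Submodule.subset_span ⟨i, rfl⟩)))
  rw [← hspan]
  refine le_antisymm (Submodule.span_mono ?_) (Submodule.span_le.2 ?_)
  · rintro _ ⟨i, rfl⟩
    exact ⟨_, rfl⟩
  · rintro _ ⟨i, rfl⟩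
    rcases eq_or_ne i j with rfl | hi
    · exact hgj
    · obtain ⟨i', rfl⟩ := Fin.exists_succAbove_eq hi
      exact Submodule.subset_span ⟨i', rfl⟩

/-- A multigraded submodule of a multigraded free module of finite rank. -/
structure GradedSubmodule (K : Type*) [Field K] (σ : Type*) where
  ι : Type
  finite : Finite ι
  s : ι → σ →₀ ℕ
  N : Submodule (MvPolynomial σ K) (ι →₀ MvPolynomial σ K)
  graded : IsMultigraded s N

namespace GradedSubmodule

variable [Finite σ] (M : GradedSubmodule K σ)

lemma exists_cover : ∃ (m : ℕ) (s' : Fin m → σ →₀ ℕ)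
      (f : (Fin m →₀ MvPolynomial σ K) →ₗ[MvPolynomial σ K] (M.ι →₀ MvPolynomial σ K)),
      IsMultihomogeneous s' M.s f ∧ LinearMap.range f = M.N ∧
      LinearMap.ker f ≤ (Ideal.span (Set.range (X : σ → MvPolynomial σ K))) •
        (⊤ : Submodule (MvPolynomial σ K) (Fin m →₀ MvPolynomial σ K)) :=
  haveI := M.finite
  exists_minimal_cover M.graded

/-- The rank of a minimal cover. -/
def rank : ℕ := M.exists_cover.choose

/-- The degrees of a minimal cover. -/
def coverShift : Fin M.rank → σ →₀ ℕ := M.exists_cover.choose_spec.choose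

/-- A minimal cover. -/
def cover : (Fin M.rank →₀ MvPolynomial σ K) →ₗ[MvPolynomial σ K] (M.ι →₀ MvPolynomial σ K) :=
  M.exists_cover.choose_spec.choose_spec.choose

lemma cover_homogeneous : IsMultihomogeneous M.coverShift M.s M.cover :=
  M.exists_cover.choose_spec.choose_spec.choose_spec.1

lemma range_cover : LinearMap.range M.cover = M.N :=
  M.exists_cover.choose_spec.choose_spec.choose_spec.2.1

lemma ker_cover_le : LinearMap.ker M.cover ≤
    (Ideal.span (Set.range (X : σ → MvPolynomial σ K))) •
      (⊤ : Submodule (MvPolynomial σ K) (Fin M.rank →₀ MvPolynomial σ K)) :=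
  M.exists_cover.choose_spec.choose_spec.choose_spec.2.2

/-- The syzygies of a minimal cover. -/
def syzygies : GradedSubmodule K σ where
  ι := Fin M.rank
  finite := inferInstance
  s := M.coverShift
  N := LinearMap.ker M.cover
  graded := M.cover_homogeneous.isMultigraded_ker

/-- The iterated syzygies. -/
def iterSyzygies : ℕ → GradedSubmodule K σ
  | 0 => M
  | k + 1 => (iterSyzygies k).syzygies

end GradedSubmodule

/-- An ideal that contains the terms of its elements, as a submodule of `S`. -/
def GradedSubmodule.ofIdeal (I : Ideal (MvPolynomial σ K))
    (hI : ∀ p ∈ I, ∀ e, monomial e (coeff e p) ∈ I) : GradedSubmodule K σ where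
  ι := Unit
  finite := inferInstance
  s := fun _ => 0
  N := Submodule.comap (Finsupp.lapply () :
    (Unit →₀ MvPolynomial σ K) →ₗ[MvPolynomial σ K] MvPolynomial σ K) I
  graded := fun y hy b => by
    rw [Submodule.mem_comap, Finsupp.lapply_apply, homogenize_apply, degreePart_apply,
      if_pos zero_le, if_pos zero_le, tsub_zero]
    exact hI _ hy b

lemma range_lapply_comp {R ι : Type*} [CommRing R] {I : Ideal R}
    {f : (ι →₀ R) →ₗ[R] (Unit →₀ R)}
    (hf : LinearMap.range f = Submodule.comap (Finsupp.lapply () : (Unit →₀ R) →ₗ[R] R) I) :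
    LinearMap.range ((Finsupp.lapply () : (Unit →₀ R) →ₗ[R] R) ∘ₗ f) = I := by
  rw [LinearMap.range_comp, hf]
  exact Submodule.map_comap_eq_of_surjective (fun p => ⟨Finsupp.single () p, by simp⟩) I

/-- An ideal that contains the terms of its elements has a minimal multigraded free
resolution. -/
theorem nonempty_minimalMultigradedResolution [Finite σ] (I : Ideal (MvPolynomial σ K))
    (hI : ∀ p ∈ I, ∀ e, monomial e (coeff e p) ∈ I) :
    Nonempty (MinimalMultigradedResolution I) := by
  let M := GradedSubmodule.ofIdeal I hI
  let S := M.iterSyzygies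
  have hS (k : ℕ) (y : Fin (S k).rank →₀ MvPolynomial σ K) :
      y ∈ LinearMap.range (S (k + 1)).cover ↔ y ∈ LinearMap.ker (S k).cover :=
    SetLike.ext_iff.1 (S (k + 1)).range_cover y
  exact ⟨{
    ι := fun k => Fin (S k).rank
    finite := fun _ => inferInstance
    shift := fun k => (S k).coverShift
    d := fun k => (S (k + 1)).cover
    aug := (Finsupp.lapply () :
      (Unit →₀ MvPolynomial σ K) →ₗ[MvPolynomial σ K] MvPolynomial σ K) ∘ₗ M.cover
    d_homogeneous := fun k => (S (k + 1)).cover_homogeneous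
    aug_homogeneous := fun j e he => (zero_add e).symm.trans (M.cover_homogeneous j () e he)
    range_aug := range_lapply_comp M.range_cover
    exact_zero := fun y => Iff.trans
      ⟨fun h => Finsupp.ext fun _ => h, fun h => DFunLike.congr_fun h ()⟩ (hS 0 y).symm
    exact_succ := fun k y => (hS (k + 1) y).symm
    minimal := fun k y hy => (S k).ker_cover_le ((hS k y).1 hy) }⟩

lemma monomial_coeff_mem_span {B : Set (σ →₀ ℕ)} {p : MvPolynomial σ K}
    (hp : p ∈ Ideal.span ((fun s => monomial s (1 : K)) '' B)) (e : σ →₀ ℕ) :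
    monomial e (coeff e p) ∈ Ideal.span ((fun s => monomial s (1 : K)) '' B) := by
  rw [mem_ideal_span_monomial_image] at *
  intro e' he'
  have h : coeff e p ≠ 0 := fun h => by simp [h] at he'
  obtain rfl : e' = e := by
    classical
    rw [support_monomial, if_neg h] at he'
    exact Finset.mem_singleton.1 he'
  exact hp _ (mem_support_iff.2 h)

/-- The homological shift ideals of the edge ideal of the complement of a chordal graph. -/
theorem homologicalShiftIdeal_edgeIdeal_compl [Finite σ] [DecidableEq σ] {G : SimpleGraph σ}
    (hG : IsChordal G) (k : ℕ) :
    homologicalShiftIdeal k (edgeIdeal K Gᶜ) = Ideal.span ((fun a => monomial a (1 : K)) ''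
      (sqfreeExp '' {W : Finset σ | W.card = k + 2 ∧ IsDisconnectedOn G W})) := by
  rw [homologicalShiftIdeal]
  congr 1
  ext p
  simp only [Set.mem_ofPred_eq, Set.mem_image]
  constructor
  · rintro ⟨F, j, rfl⟩
    obtain ⟨W, h1, h2, h3⟩ := (F.exists_shift_eq_iff hG k _).1 ⟨j, rfl⟩
    exact ⟨_, ⟨W, ⟨h1, h2⟩, rfl⟩, by rw [h3]⟩
  · rintro ⟨_, ⟨W, ⟨h1, h2⟩, rfl⟩, rfl⟩
    -- The generators of the shift ideal range over all resolutions, so at least one is needed to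
    -- produce this one.
    obtain ⟨F⟩ := nonempty_minimalMultigradedResolution (edgeIdeal K Gᶜ) fun p hp e => by
      rw [edgeIdeal_eq_span_monomial] at *
      exact monomial_coeff_mem_span hp e
    obtain ⟨j, hj⟩ := (F.exists_shift_eq_iff hG k _).2 ⟨W, h1, h2, rfl⟩
    exact ⟨F, j, by rw [hj]⟩

end Existence

/-! ### Criteria for and against linear quotients -/

section LinearQuotients

variable {K : Type*} [Field K] {σ : Type*}

/-- The ideal generated by the squarefree monomials with supports in `S`. -/
def sqfreeIdeal (K : Type*) [Field K] {σ : Type*} (S : Set (Finset σ)) :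
    Ideal (MvPolynomial σ K) :=
  Ideal.span ((fun a => monomial a (1 : K)) '' (sqfreeExp '' S))

lemma monomial_mem_span_monomial_iff {B : Set (σ →₀ ℕ)} {a : σ →₀ ℕ} :
    monomial a (1 : K) ∈ Ideal.span ((fun s => monomial s (1 : K)) '' B) ↔ ∃ b ∈ B, b ≤ a := by
  classical
  rw [mem_ideal_span_monomial_image]
  simp [support_monomial]

lemma monomial_mem_sqfreeIdeal_iff {S : Set (Finset σ)} {a : σ →₀ ℕ} :
    monomial a (1 : K) ∈ sqfreeIdeal K S ↔ ∃ W ∈ S, W ⊆ a.support := by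
  rw [sqfreeIdeal, monomial_mem_span_monomial_iff]
  simp [sqfreeExp_le_iff]

/-- Squarefree monomials of equal degree do not properly divide each other. -/
lemma minGens_sqfreeIdeal {S : Set (Finset σ)} {s : ℕ} (hS : ∀ W ∈ S, W.card = s) :
    minGens (sqfreeIdeal K S) = sqfreeExp '' S := by
  ext a
  constructor
  · rintro ⟨ha, hmin⟩
    obtain ⟨W, hW, hWa⟩ := monomial_mem_sqfreeIdeal_iff.1 ha
    have hle : sqfreeExp W ≤ a := sqfreeExp_le_iff.2 hWa
    refine ⟨W, hW, le_antisymm hle (hmin ?_ hle)⟩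
    exact monomial_mem_sqfreeIdeal_iff.2 ⟨W, hW, by simp⟩
  · rintro ⟨W, hW, rfl⟩
    refine ⟨monomial_mem_sqfreeIdeal_iff.2 ⟨W, hW, by simp⟩, fun b hb hle => ?_⟩
    obtain ⟨W', hW', hb'⟩ := monomial_mem_sqfreeIdeal_iff.1 hb
    have h1 : W' ⊆ W := by
      have := hb'.trans (Finsupp.support_mono hle)
      rwa [support_sqfreeExp] at this
    obtain rfl := Finset.eq_of_subset_of_card_le h1 (by rw [hS _ hW, hS _ hW'])
    exact sqfreeExp_le_iff.2 hb'

lemma setOf_monomial_eq_image {q : ℕ} (m : Fin q → (σ →₀ ℕ)) (i : Fin q) :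
    {p | ∃ l : Fin q, l < i ∧ p = monomial (m l) (1 : K)} =
      (fun s => monomial s (1 : K)) '' (m '' {l | l < i}) := by
  ext p
  simp [eq_comm]

lemma add_mem_support_mul_monomial {f : MvPolynomial σ K} {e : σ →₀ ℕ} (he : e ∈ f.support)
    (a : σ →₀ ℕ) : e + a ∈ (f * monomial a 1).support := by
  rw [mem_support_iff, coeff_mul_monomial, mul_one]
  exact mem_support_iff.1 he

variable [DecidableEq σ]

/-- An exchange property along an ordering of the generators gives linear quotients. -/
theorem hasLinearQuotients_of_exchange {κ : Type*} [LinearOrder κ] {S : Finset (Finset σ)} {s : ℕ}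
    (hS : ∀ W ∈ S, W.card = s) (key : Finset σ → κ) (hkey : Set.InjOn key S)
    (hex : ∀ W ∈ S, ∀ W' ∈ S, key W' < key W →
      ∃ v ∈ W', v ∉ W ∧ ∃ W'' ∈ S, key W'' < key W ∧ W'' ⊆ insert v W) :
    HasLinearQuotients (sqfreeIdeal K (S : Set (Finset σ))) := by
  let e := (S.image key).orderIsoOfFin rfl
  have hw : ∀ i, ∃ W ∈ S, key W = e i := fun i => Finset.mem_image.1 (e i).2
  choose w hwS hwk using hw
  have hlt : ∀ i j, i < j ↔ key (w i) < key (w j) := fun i j => by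
    rw [hwk, hwk, Subtype.coe_lt_coe, e.lt_iff_lt]
  have hwinj : Function.Injective w := fun i j h => by
    by_contra hne
    rcases lt_or_gt_of_ne hne with h1 | h1 <;> rw [hlt, h] at h1 <;> exact lt_irrefl _ h1
  have hwsurj : ∀ W ∈ S, ∃ i, w i = W := fun W hW => by
    obtain ⟨i, hi⟩ := e.surjective ⟨key W, Finset.mem_image_of_mem _ hW⟩
    exact ⟨i, hkey (hwS i) hW (by rw [hwk, hi])⟩
  -- The variables generating the colon are those `v` outside `w i` for which an earlier generator
  -- divides `x_v` times the `i`-th one.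
  refine ⟨_, fun i => sqfreeExp (w i), sqfreeExp_injective.comp hwinj, ?_, fun i =>
    ⟨{v | v ∉ w i ∧ ∃ l < i, w l ⊆ insert v (w i)}, ?_⟩⟩
  · rw [minGens_sqfreeIdeal hS]
    ext a
    constructor
    · rintro ⟨i, rfl⟩
      exact ⟨_, hwS i, rfl⟩
    · rintro ⟨W, hW, rfl⟩
      obtain ⟨i, rfl⟩ := hwsurj W hW
      exact ⟨i, rfl⟩
  · rw [setOf_monomial_eq_image]
    refine le_antisymm (fun f hf => ?_) (Ideal.span_le.2 ?_)
    · rw [Submodule.mem_colon_singleton, smul_eq_mul, mem_ideal_span_monomial_image] at hf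
      rw [mem_ideal_span_X_image]
      intro a ha
      obtain ⟨_, ⟨l, hl, rfl⟩, hle⟩ := hf _ (add_mem_support_mul_monomial ha _)
      obtain ⟨v, hv, hvi, W'', hW'', hk, hsub⟩ :=
        hex _ (hwS i) _ (hwS l) ((hlt l i).1 hl)
      obtain ⟨j, rfl⟩ := hwsurj W'' hW''
      refine ⟨v, ⟨hvi, j, (hlt j i).2 hk, hsub⟩, ?_⟩
      have := hle v
      simp only [Finsupp.add_apply, sqfreeExp_apply, if_pos hv, if_neg hvi] at this
      omega
    · rintro _ ⟨v, ⟨hv, l, hl, hsub⟩, rfl⟩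
      rw [SetLike.mem_coe, Submodule.mem_colon_singleton, smul_eq_mul, X, monomial_mul, one_mul,
        monomial_mem_span_monomial_iff]
      refine ⟨_, ⟨l, hl, rfl⟩, sqfreeExp_le_iff.2 fun x hx => ?_⟩
      rcases Finset.mem_insert.1 (hsub hx) with rfl | hx
      · simp
      · simp [sqfreeExp_apply, hx]

/-- Two generators which are not linearly connected within the divisors of their least common
multiple prevent linear quotients. -/
theorem not_hasLinearQuotients_of_pair {S : Set (Finset σ)} {s : ℕ} (hS : ∀ W ∈ S, W.card = s)
    {W₁ W₂ : Finset σ} (h₁ : W₁ ∈ S) (h₂ : W₂ ∈ S) (h₁₂ : 1 < (W₁ \ W₂).card)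
    (h₂₁ : 1 < (W₂ \ W₁).card) (h : ∀ W ∈ S, W ⊆ W₁ ∪ W₂ → W = W₁ ∨ W = W₂) :
    ¬ HasLinearQuotients (sqfreeIdeal K S) := by
  rintro ⟨q, m, hm, hrange, hcol⟩
  rw [minGens_sqfreeIdeal hS] at hrange
  have key : ∀ A ∈ S, ∀ B ∈ S, 1 < (A \ B).card → (∀ W ∈ S, W ⊆ A ∪ B → W = A ∨ W = B) →
      ∀ i j, m i = sqfreeExp A → m j = sqfreeExp B → ¬ i < j := by
    intro A hA B hB hAB h i j hi hj hij
    obtain ⟨T, hT⟩ := hcol j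
    rw [setOf_monomial_eq_image] at hT
    -- The colon contains `x_{A \ B}`, hence one of its variables `v`. An earlier generator then
    -- lies in `insert v B`, thus in `A ∪ B`. Being `A`, it would force `A \ B ⊆ {v}`; being `B`, it
    -- would not be earlier.
    have h1 : monomial (sqfreeExp (A \ B)) (1 : K) ∈ Ideal.span (X '' T) := by
      rw [← hT, Submodule.mem_colon_singleton, smul_eq_mul, monomial_mul, one_mul,
        monomial_mem_span_monomial_iff]
      refine ⟨_, ⟨i, hij, rfl⟩, ?_⟩
      rw [hi, hj, sqfreeExp_le_iff]
      intro x hx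
      simp only [Finsupp.mem_support_iff, Finsupp.add_apply, sqfreeExp_apply, Finset.mem_sdiff]
      by_cases hxB : x ∈ B <;> simp [hx, hxB]
    rw [mem_ideal_span_X_image] at h1
    obtain ⟨v, hvT, hv⟩ := h1 (sqfreeExp (A \ B)) (by simp)
    have hvAB : v ∈ A \ B := by
      by_contra h
      exact hv (by rw [sqfreeExp_apply, if_neg h])
    have h2 : (X v : MvPolynomial σ K) ∈ Ideal.span (X '' T) :=
      Ideal.subset_span ⟨v, hvT, rfl⟩
    rw [← hT, Submodule.mem_colon_singleton, smul_eq_mul, X, monomial_mul, one_mul,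
      monomial_mem_span_monomial_iff] at h2
    obtain ⟨_, ⟨l, hl, rfl⟩, hle⟩ := h2
    obtain ⟨W, hW, hWl⟩ : m l ∈ sqfreeExp '' S := hrange ▸ ⟨l, rfl⟩
    rw [← hWl, hj, sqfreeExp_le_iff] at hle
    have hsub : W ⊆ insert v B := fun x hx => by
      have := hle hx
      by_contra hn
      rw [Finset.mem_insert, not_or] at hn
      simp [sqfreeExp_apply, hn] at this
    have hsub' : W ⊆ A ∪ B := fun x hx => by
      rcases Finset.mem_insert.1 (hsub hx) with rfl | hx
      · exact Finset.mem_union_left _ (Finset.mem_sdiff.1 hvAB).1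
      · exact Finset.mem_union_right _ hx
    rcases h W hW hsub' with rfl | rfl
    · have h3 : W \ B ⊆ {v} := fun x hx => by
        rw [Finset.mem_sdiff] at hx
        exact Finset.mem_singleton.2 ((Finset.mem_insert.1 (hsub hx.1)).resolve_right hx.2)
      have := Finset.card_le_card h3
      rw [Finset.card_singleton] at this
      omega
    · exact absurd (hm (hWl.symm.trans hj.symm)) (ne_of_lt hl)
  obtain ⟨i, hi⟩ : sqfreeExp W₁ ∈ Set.range m := hrange ▸ ⟨W₁, h₁, rfl⟩
  obtain ⟨j, hj⟩ : sqfreeExp W₂ ∈ Set.range m := hrange ▸ ⟨W₂, h₂, rfl⟩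
  rcases lt_trichotomy i j with hij | rfl | hij
  · exact key W₁ h₁ W₂ h₂ h₁₂ h i j hi hj hij
  · obtain rfl := sqfreeExp_injective (hi.symm.trans hj)
    simp at h₁₂
  · exact key W₂ h₂ W₁ h₁ h₂₁ (fun W hW hsub => (h W hW (by rwa [Finset.union_comm])).symm)
      j i hj hi hij

end LinearQuotients

/-! ### The labelled graph, its disconnected sets and the order on them -/

section Labelling

variable {σ : Type*}

/-- The vertices of the graph are labelled by `1, …, M + 2`: the labels up to `r` form a clique, the
labels `r + 1, …, M` form a path, `M + 1` is adjacent to all vertices but `r + 1`, and `M + 2` is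
adjacent to all vertices but `M`. -/
structure IsCHLabelling (G : SimpleGraph σ) (r M : ℕ) (π : σ → ℕ) : Prop where
  injective : Function.Injective π
  one_le : ∀ v, 1 ≤ π v
  le : ∀ v, π v ≤ M + 2
  exists_eq : ∀ i, 1 ≤ i → i ≤ M + 2 → ∃ v, π v = i
  adj_iff : ∀ u v, π u < π v → (G.Adj u v ↔ π v ≤ r ∨ (r < π u ∧ π v = π u + 1 ∧ π v ≤ M) ∨
    (π v = M + 1 ∧ π u ≠ r + 1) ∨ (π v = M + 2 ∧ π u ≠ M))
  add_four_le : r + 4 ≤ M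

/-- `W` contains neither `M + 1` nor `M + 2`, and is neither contained in the clique nor an interval
of the path. -/
def IsPathType (r M : ℕ) (π : σ → ℕ) (W : Finset σ) : Prop :=
  (∀ v ∈ W, π v ≤ M) ∧ ((∃ x ∈ W, ∃ y ∈ W, π x ≤ r ∧ r < π y) ∨
    ∃ x ∈ W, ∃ y ∈ W, ∃ z ∉ W, r < π x ∧ π x < π z ∧ π z < π y)

/-- `M` is isolated in `W`, which contains `M + 2`. -/
def IsLastType (M : ℕ) (π : σ → ℕ) (W : Finset σ) : Prop :=
  (∃ v ∈ W, π v = M + 2) ∧ (∃ v ∈ W, π v = M) ∧ ∀ v ∈ W, π v + 1 ≠ M ∧ π v ≠ M + 1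

/-- `r + 1` is isolated in `W`, which contains `M + 1`. -/
def IsFirstType (r M : ℕ) (π : σ → ℕ) (W : Finset σ) : Prop :=
  (∃ v ∈ W, π v = M + 1) ∧ (∃ v ∈ W, π v = r + 1) ∧ ∀ v ∈ W, π v ≠ r + 2 ∧ π v ≠ M + 2

namespace IsCHLabelling

variable [DecidableEq σ] {G : SimpleGraph σ} {r M : ℕ} {π : σ → ℕ} (h : IsCHLabelling G r M π)
include h

/-- If `W` has no gap, walking along the path from `x` never leaves `W`, hence never leaves `A`, and
so reaches `y` inside `A`. -/
lemma false_of_lt {W A B : Finset σ} (hd : Disjoint A B) (hAB : A ∪ B = W)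
    (hadj : ∀ x ∈ A, ∀ y ∈ B, ¬ G.Adj x y) (hM : ∀ v ∈ W, π v ≤ M)
    (hW : ¬ IsPathType r M π W) {x y : σ} (hx : x ∈ A) (hy : y ∈ B) (hxy : π x < π y) : False := by
  have hxW : x ∈ W := hAB ▸ Finset.mem_union_left _ hx
  have hyW : y ∈ W := hAB ▸ Finset.mem_union_right _ hy
  have hyM := hM y hyW
  have hyr : r < π y := by
    by_contra hyr
    exact hadj x hx y hy ((h.adj_iff x y hxy).2 (Or.inl (by omega)))
  have hxr : r < π x := by
    by_contra hxr
    exact hW ⟨hM, Or.inl ⟨x, hxW, y, hyW, by omega, hyr⟩⟩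
  have key : ∀ i, π x ≤ i → i ≤ π y → ∃ v ∈ A, π v = i := by
    intro i hi
    induction i, hi using Nat.le_induction with
    | base => exact fun _ => ⟨x, hx, rfl⟩
    | succ i hi ih =>
      intro hiy
      obtain ⟨v, hv, hvi⟩ := ih (by omega)
      obtain ⟨w, hw⟩ := h.exists_eq (i + 1) (by omega) (by omega)
      have hwW : w ∈ W := by
        by_contra hwW
        rcases Nat.lt_or_ge (i + 1) (π y) with h1 | h1
        · exact hW ⟨hM, Or.inr ⟨x, hxW, y, hyW, w, hwW, hxr, by omega, by omega⟩⟩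
        · exact hwW (h.injective (show π w = π y by omega) ▸ hyW)
      rw [← hAB, Finset.mem_union] at hwW
      refine ⟨w, hwW.resolve_right fun hwB => hadj v hv w hwB ?_, hw⟩
      exact (h.adj_iff v w (by omega)).2 (Or.inr (Or.inl ⟨by omega, by omega, by omega⟩))
  obtain ⟨v, hv, hvy⟩ := key (π y) hxy.le le_rfl
  exact Finset.disjoint_left.1 hd hv (h.injective hvy ▸ hy)

/-- If `M + 2` is in `W`, the part without it can only be `{M}`, and failing that, if `M + 1` is in
`W`, the other part can only be `{r + 1}`. Without both, `W` lies in the disjoint union of a clique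
and a path. -/
lemma isDisconnectedOn_iff (W : Finset σ) : IsDisconnectedOn G W ↔
    IsPathType r M π W ∨ IsLastType M π W ∨ IsFirstType r M π W := by
  have h4 := h.add_four_le
  constructor
  · intro hW
    by_cases hb : ∃ b ∈ W, π b = M + 2
    · obtain ⟨b, hbW, hb⟩ := hb
      obtain ⟨A, B, hbA, ⟨y, hy⟩, hd, hAB, hadj⟩ := hW.exists_mem hbW
      have hB : ∀ x ∈ B, π x = M := fun x hx => by
        by_contra hne
        have hxb : π x ≠ M + 2 := fun e => Finset.disjoint_left.1 hd hbA
          (h.injective (hb.trans e.symm) ▸ hx)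
        have := h.le x
        exact hadj b hbA x hx ((h.adj_iff x b (by omega)).2 (by omega)).symm
      refine Or.inr (Or.inl ⟨⟨b, hbW, hb⟩, ⟨y, hAB ▸ Finset.mem_union_right _ hy, hB y hy⟩, ?_⟩)
      intro v hv
      by_contra hne
      have hyM := hB y hy
      rw [← hAB, Finset.mem_union] at hv
      rcases hv with hv | hv
      · rcases Nat.lt_or_ge (π v) M with h1 | h1
        · exact hadj v hv y hy ((h.adj_iff v y (by omega)).2 (by omega))
        · exact hadj v hv y hy ((h.adj_iff y v (by omega)).2 (by omega)).symm
      · have := hB v hv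
        omega
    by_cases ha : ∃ a ∈ W, π a = M + 1
    · obtain ⟨a, haW, ha⟩ := ha
      obtain ⟨A, B, haA, ⟨y, hy⟩, hd, hAB, hadj⟩ := hW.exists_mem haW
      have hB : ∀ x ∈ B, π x = r + 1 := fun x hx => by
        by_contra hne
        have hxa : π x ≠ M + 1 := fun e => Finset.disjoint_left.1 hd haA
          (h.injective (ha.trans e.symm) ▸ hx)
        have hxb : π x ≠ M + 2 := fun e => hb ⟨x, hAB ▸ Finset.mem_union_right _ hx, e⟩
        have := h.le x
        exact hadj a haA x hx ((h.adj_iff x a (by omega)).2 (by omega)).symm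
      refine Or.inr (Or.inr ⟨⟨a, haW, ha⟩, ⟨y, hAB ▸ Finset.mem_union_right _ hy, hB y hy⟩, ?_⟩)
      refine fun v hv => ⟨fun hne => ?_, fun e => hb ⟨v, hv, e⟩⟩
      have hyM := hB y hy
      rw [← hAB, Finset.mem_union] at hv
      rcases hv with hv | hv
      · exact hadj v hv y hy ((h.adj_iff y v (by omega)).2 (by omega)).symm
      · have := hB v hv
        omega
    left
    have hM : ∀ v ∈ W, π v ≤ M := fun v hv => by
      have h1 := h.le v
      have h2 : π v ≠ M + 2 := fun e => hb ⟨v, hv, e⟩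
      have h3 : π v ≠ M + 1 := fun e => ha ⟨v, hv, e⟩
      omega
    by_contra hne
    obtain ⟨A, B, ⟨x, hx⟩, ⟨y, hy⟩, hd, hAB, hadj⟩ := hW
    rcases lt_trichotomy (π x) (π y) with hxy | hxy | hxy
    · exact h.false_of_lt hd hAB hadj hM hne hx hy hxy
    · exact Finset.disjoint_left.1 hd hx (h.injective hxy ▸ hy)
    · exact h.false_of_lt hd.symm ((Finset.union_comm _ _).trans hAB)
        (fun u hu v hv e => hadj v hv u hu e.symm) hM hne hy hx hxy
  · rintro (⟨hM, ⟨x, hx, y, hy, hxr, hyr⟩ | ⟨x, hx, y, hy, z, hz, hxr, hxz, hzy⟩⟩ |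
      ⟨⟨b, hb, hb'⟩, ⟨c, hc, hc'⟩, hW⟩ | ⟨⟨a, ha, ha'⟩, ⟨c, hc, hc'⟩, hW⟩)
    · refine ⟨W.filter (π · ≤ r), W.filter (r < π ·), ⟨x, by simp [hx, hxr]⟩,
        ⟨y, by simp [hy, hyr]⟩, ?_, ?_, fun u hu v hv => ?_⟩
      · exact Finset.disjoint_filter.2 fun _ _ _ _ => by omega
      · ext v; simp only [Finset.mem_union, Finset.mem_filter, ← and_or_left]
        exact ⟨fun h => h.1, fun h => ⟨h, by omega⟩⟩
      · rw [Finset.mem_filter] at hu hv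
        have := hM v hv.1
        rw [h.adj_iff u v (by omega)]
        omega
    · refine ⟨W.filter (π · < π z), W.filter (π z < π ·), ⟨x, by simp [hx, hxz]⟩,
        ⟨y, by simp [hy, hzy]⟩, ?_, ?_, fun u hu v hv => ?_⟩
      · exact Finset.disjoint_filter.2 fun _ _ _ _ => by omega
      · ext v; simp only [Finset.mem_union, Finset.mem_filter, ← and_or_left]
        refine ⟨fun h => h.1, fun hv => ⟨hv, lt_or_gt_of_ne fun e => hz ?_⟩⟩
        exact h.injective e ▸ hv
      · rw [Finset.mem_filter] at hu hv
        have := hM v hv.1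
        rw [h.adj_iff u v (by omega)]
        omega
    · refine isDisconnectedOn_of_isolated hc
        ⟨b, Finset.mem_erase.2 ⟨fun e => by rw [e] at hb'; omega, hb⟩⟩ fun x hx hadj => ?_
      have h1 := hW x hx
      have h2 := h.le x
      have h3 : π c ≠ π x := fun e => hadj.ne (h.injective e)
      rcases lt_or_gt_of_ne h3 with h3 | h3
      · rw [h.adj_iff c x h3] at hadj
        omega
      · rw [G.adj_comm, h.adj_iff x c h3] at hadj
        omega
    · refine isDisconnectedOn_of_isolated hc
        ⟨a, Finset.mem_erase.2 ⟨fun e => by rw [e] at ha'; omega, ha⟩⟩ fun x hx hadj => ?_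
      have h1 := hW x hx
      have h2 := h.le x
      have h3 : π c ≠ π x := fun e => hadj.ne (h.injective e)
      rcases lt_or_gt_of_ne h3 with h3 | h3
      · rw [h.adj_iff c x h3] at hadj
        omega
      · rw [G.adj_comm, h.adj_iff x c h3] at hadj
        omega

end IsCHLabelling

/-- The labels used to order the generators by type. -/
def typeIndex (M : ℕ) (π : σ → ℕ) (W : Finset σ) : ℕ :=
  if M + 1 ∈ W.image π then 2 else if M + 2 ∈ W.image π then 1 else 0

/-- Generators are ordered by type, and then by the reverse colexicographic order. -/
def orderKey (M : ℕ) (π : σ → ℕ) (W : Finset σ) : ℕ ×ₗ (Colex (Finset ℕ))ᵒᵈ :=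
  toLex (typeIndex M π W, OrderDual.toDual (toColex (W.image π)))

lemma orderKey_lt_iff {M : ℕ} {π : σ → ℕ} (hπ : Function.Injective π) {W W' : Finset σ} :
    orderKey M π W' < orderKey M π W ↔ typeIndex M π W' < typeIndex M π W ∨
      (typeIndex M π W' = typeIndex M π W ∧
        ∃ v ∈ W', v ∉ W ∧ ∀ u ∈ W, u ∉ W' → π u < π v) := by
  rw [orderKey, orderKey, Prod.Lex.toLex_lt_toLex]
  simp only [OrderDual.toDual_lt_toDual, Finset.Colex.toColex_lt_toColex_iff_exists_forall_lt]
  simp [hπ.eq_iff]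

lemma orderKey_injective {M : ℕ} {π : σ → ℕ} (hπ : Function.Injective π) :
    Function.Injective (orderKey M π) := by
  intro W W' h
  have h1 := (Prod.mk.inj (toLex.injective h)).2
  exact Finset.image_injective hπ (toColex.injective (OrderDual.toDual.injective h1))

lemma orderKey_exchange_lt [DecidableEq σ] {M : ℕ} {π : σ → ℕ} (hπ : Function.Injective π) {W : Finset σ}
    {u v : σ} (hv : v ∉ W) (huv : π u < π v)
    (ht : typeIndex M π (insert v (W.erase u)) = typeIndex M π W) :
    orderKey M π (insert v (W.erase u)) < orderKey M π W := by
  refine (orderKey_lt_iff hπ).2 (Or.inr ⟨ht, v, Finset.mem_insert_self _ _, hv, fun x hx hx' => ?_⟩)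
  have : x = u := by
    by_contra hne
    exact hx' (Finset.mem_insert_of_mem (Finset.mem_erase.2 ⟨hne, hx⟩))
  rwa [this]

lemma IsPathType.typeIndex_eq {r M : ℕ} {π : σ → ℕ} {W : Finset σ} (h : IsPathType r M π W) :
    typeIndex M π W = 0 := by
  have h1 := h.1
  rw [typeIndex, if_neg, if_neg] <;> rw [Finset.mem_image] <;> rintro ⟨v, hv, e⟩ <;>
    have := h1 v hv <;> omega

lemma IsLastType.typeIndex_eq {M : ℕ} {π : σ → ℕ} {W : Finset σ} (h : IsLastType M π W) :
    typeIndex M π W = 1 := by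
  obtain ⟨⟨b, hb, hb'⟩, _, h1⟩ := h
  rw [typeIndex, if_neg, if_pos]
  · exact Finset.mem_image.2 ⟨b, hb, hb'⟩
  · rw [Finset.mem_image]
    rintro ⟨v, hv, e⟩
    exact (h1 v hv).2 e

lemma IsFirstType.typeIndex_eq {r M : ℕ} {π : σ → ℕ} {W : Finset σ} (h : IsFirstType r M π W) :
    typeIndex M π W = 2 := by
  obtain ⟨⟨b, hb, hb'⟩, _, h1⟩ := h
  rw [typeIndex, if_pos]
  exact Finset.mem_image.2 ⟨b, hb, hb'⟩

end Labelling

/-! ### The exchange property -/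

section Exchange

variable {σ : Type*} [DecidableEq σ]

lemma card_insert_erase {W : Finset σ} {u v : σ} (hu : u ∈ W) (hv : v ∉ W) :
    (insert v (W.erase u)).card = W.card := by
  rw [Finset.card_insert_of_notMem fun h => hv (Finset.mem_of_mem_erase h),
    Finset.card_erase_of_mem hu]
  have := Finset.card_pos.2 ⟨u, hu⟩
  omega

lemma subset_insert_of_forall {W W' : Finset σ} {v : σ} (h : ∀ x ∈ W', x ∉ W → x = v) :
    W' ⊆ insert v W := fun x hx => by
  by_cases hxW : x ∈ W
  · exact Finset.mem_insert_of_mem hxW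
  · rw [h x hx hxW]
    exact Finset.mem_insert_self _ _

/-- Replacing one element of `W` gives an earlier set of the family. -/
def Exchange (G : SimpleGraph σ) (M : ℕ) (π : σ → ℕ) (W W' : Finset σ) : Prop :=
  ∃ v ∈ W', v ∉ W ∧ ∃ W'', (W''.card = W.card ∧ IsDisconnectedOn G W'') ∧
    orderKey M π W'' < orderKey M π W ∧ W'' ⊆ insert v W

lemma exchange_self {G : SimpleGraph σ} {M : ℕ} {π : σ → ℕ} {W W' : Finset σ} (hW' : IsDisconnectedOn G W')
    (hc : W'.card = W.card) (hk : orderKey M π W' < orderKey M π W) {v : σ}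
    (hv : W' ⊆ insert v W) : Exchange G M π W W' := by
  have hvW' : v ∈ W' ∧ v ∉ W := by
    by_contra hne
    have hsub : W' ⊆ W := fun x hx => by
      rcases Finset.mem_insert.1 (hv hx) with rfl | hxW
      · by_contra hxW
        exact hne ⟨hx, hxW⟩
      · exact hxW
    rw [Finset.eq_of_subset_of_card_le hsub hc.ge] at hk
    exact lt_irrefl _ hk
  exact ⟨v, hvW'.1, hvW'.2, W', ⟨hc, hW'⟩, hk, hv⟩

namespace IsCHLabelling

variable {G : SimpleGraph σ} {r M : ℕ} {π : σ → ℕ} (h : IsCHLabelling G r M π)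
include h

lemma exchange_swap {W W' : Finset σ} {u v : σ} (hu : u ∈ W) (hv : v ∉ W)
    (hv' : v ∈ W') (hd : IsPathType r M π (insert v (W.erase u)) ∨
      IsLastType M π (insert v (W.erase u)) ∨ IsFirstType r M π (insert v (W.erase u)))
    (hk : orderKey M π (insert v (W.erase u)) < orderKey M π W) : Exchange G M π W W' :=
  ⟨v, hv', hv, _, ⟨card_insert_erase hu hv, (h.isDisconnectedOn_iff _).2 hd⟩, hk,
    Finset.insert_subset_insert _ (Finset.erase_subset _ _)⟩

/-- Let `v` be the largest label in the difference; it belongs to `W'`. If `W` has two elements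
below `v`, replacing the upper one by `v` creates a gap or keeps a clique vertex next to a path
vertex. Otherwise `W \ W'` has at most one element and `W'` itself works. -/
lemma exchange_path {W W' : Finset σ} (hW : IsPathType r M π W) (hW' : IsPathType r M π W')
    (hc : W'.card = W.card) (hk : orderKey M π W' < orderKey M π W) : Exchange G M π W W' := by
  obtain ⟨v, hv', hv, hmax⟩ : ∃ v ∈ W', v ∉ W ∧ ∀ u ∈ W, u ∉ W' → π u < π v := by
    rw [orderKey_lt_iff h.injective, hW.typeIndex_eq, hW'.typeIndex_eq] at hk
    exact (hk.resolve_left (lt_irrefl _)).2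
  by_cases hu : ∃ u₁ ∈ W, ∃ u₂ ∈ W, π u₁ < π u₂ ∧ π u₂ < π v
  · obtain ⟨u₁, hu₁, u₂, hu₂, h12, h2v⟩ := hu
    have hne₁ : u₁ ≠ u₂ := fun e => by rw [e] at h12; exact lt_irrefl _ h12
    have hne₂ : u₂ ≠ v := fun e => hv (e ▸ hu₂)
    have hu₁' : u₁ ∈ insert v (W.erase u₂) := by simp [hu₁, hne₁]
    have hvv : v ∈ insert v (W.erase u₂) := by simp
    have hp : IsPathType r M π (insert v (W.erase u₂)) := by
      refine ⟨fun x hx => ?_, ?_⟩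
      · rcases Finset.mem_insert.1 hx with rfl | hx
        · exact hW'.1 _ hv'
        · exact hW.1 _ (Finset.mem_of_mem_erase hx)
      rcases Nat.lt_or_ge r (π u₁) with hr | hr
      · exact Or.inr ⟨u₁, hu₁', v, hvv, u₂, by simp [hne₂], hr, h12, h2v⟩
      · left
        obtain ⟨y, hy, hyr⟩ : ∃ y ∈ W, r < π y := by
          rcases hW.2 with ⟨_, _, y, hy, _, hyr⟩ | ⟨y, hy, _, _, _, _, hyr, _⟩
          · exact ⟨y, hy, hyr⟩
          · exact ⟨y, hy, hyr⟩
        by_cases hyu : y = u₂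
        · exact ⟨u₁, hu₁', v, hvv, hr, by rw [hyu] at hyr; omega⟩
        · exact ⟨u₁, hu₁', y, by simp [hy, hyu], hr, hyr⟩
    exact h.exchange_swap hu₂ hv hv' (Or.inl hp) (orderKey_exchange_lt h.injective hv h2v
      (by rw [hp.typeIndex_eq, hW.typeIndex_eq]))
  · push Not at hu
    have h1 : (W' \ W).card ≤ 1 := by
      rw [Finset.card_sdiff_comm hc, Finset.card_le_one]
      intro x hx y hy
      rw [Finset.mem_sdiff] at hx hy
      have hxv := hmax x hx.1 hx.2
      have hyv := hmax y hy.1 hy.2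
      by_contra hne
      rcases lt_or_gt_of_ne (fun e => hne (h.injective e)) with hlt | hlt
      · have := hu x hx.1 y hy.1 hlt; omega
      · have := hu y hy.1 x hx.1 hlt; omega
    refine exchange_self ((h.isDisconnectedOn_iff _).2 (Or.inl hW')) hc hk (v := v)
      (subset_insert_of_forall fun x hx hxW => ?_)
    exact Finset.card_le_one.1 h1 x (Finset.mem_sdiff.2 ⟨hx, hxW⟩) v
      (Finset.mem_sdiff.2 ⟨hv', hv⟩)

/-- Against a set of path type, trade `M + 2` for a new vertex other than `M - 1`: the missing `M -
1` keeps `M` isolated. If no such vertex exists, `W'` adds only `M - 1`. Within the type, any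
element of `W \ W'` may be traded. -/
lemma exchange_last {W W' : Finset σ} (hW : IsLastType M π W)
    (hW' : IsPathType r M π W' ∨ IsLastType M π W' ∨ IsFirstType r M π W')
    (hc : W'.card = W.card) (hk : orderKey M π W' < orderKey M π W) : Exchange G M π W W' := by
  have h4 := h.add_four_le
  have hk' := (orderKey_lt_iff h.injective).1 hk
  obtain ⟨⟨b, hb, hbM⟩, ⟨c, hc', hcM⟩, hWn⟩ := id hW
  rcases id hW' with hA | hB | hC
  · by_cases hex : ∃ v ∈ W', v ∉ W ∧ π v + 1 ≠ M
    · obtain ⟨v, hv', hv, hvM⟩ := hex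
      have hvle := hA.1 v hv'
      have hvc : π v ≠ M := fun e => hv (h.injective (e.trans hcM.symm) ▸ hc')
      have hcb : c ≠ b := fun e => by rw [e] at hcM; omega
      obtain ⟨z, hz⟩ := h.exists_eq (M - 1) (by omega) (by omega)
      have hzW : z ∉ insert v (W.erase b) := fun hzW => by
        rcases Finset.mem_insert.1 hzW with rfl | hzW
        · omega
        · have := hWn z (Finset.mem_of_mem_erase hzW); omega
      have hp : IsPathType r M π (insert v (W.erase b)) := by
        refine ⟨fun x hx => ?_, ?_⟩
        · rcases Finset.mem_insert.1 hx with rfl | hx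
          · exact hvle
          · rw [Finset.mem_erase] at hx
            have h1 := h.le x
            have h2 := hWn x hx.2
            have h3 : π x ≠ π b := fun e => hx.1 (h.injective e)
            omega
        rcases Nat.lt_or_ge r (π v) with hr | hr
        · exact Or.inr ⟨v, by simp, c, by simp [hc', hcb], z, hzW, hr, by omega, by omega⟩
        · exact Or.inl ⟨v, by simp, c, by simp [hc', hcb], hr, by omega⟩
      refine h.exchange_swap hb hv hv' (Or.inl hp) ((orderKey_lt_iff h.injective).2 (Or.inl ?_))
      rw [hp.typeIndex_eq, hW.typeIndex_eq]
      exact one_pos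
    · push Not at hex
      obtain ⟨z, hz⟩ := h.exists_eq (M - 1) (by omega) (by omega)
      refine exchange_self ((h.isDisconnectedOn_iff _).2 hW') hc hk (v := z)
        (subset_insert_of_forall fun x hx hxW => h.injective ?_)
      have := hex x hx hxW
      omega
  · rw [hB.typeIndex_eq, hW.typeIndex_eq] at hk'
    obtain ⟨-, v, hv', hv, hmax⟩ := hk'.resolve_left (lt_irrefl _)
    obtain ⟨u, hu, hu'⟩ : ∃ u ∈ W, u ∉ W' := by
      by_contra! hsub
      have := Finset.eq_of_subset_of_card_le hsub hc.le
      exact hv (this ▸ hv')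
    obtain ⟨⟨b', hb', hbM'⟩, ⟨c', hc'', hcM'⟩, hWn'⟩ := hB
    have hub : b ≠ u := fun e => hu' (e ▸ h.injective (hbM'.trans hbM.symm) ▸ hb')
    have huc : c ≠ u := fun e => hu' (e ▸ h.injective (hcM'.trans hcM.symm) ▸ hc'')
    have hp : IsLastType M π (insert v (W.erase u)) := by
      refine ⟨⟨b, by simp [hb, hub], hbM⟩, ⟨c, by simp [hc', huc], hcM⟩, fun x hx => ?_⟩
      rcases Finset.mem_insert.1 hx with rfl | hx
      · exact hWn' _ hv'
      · exact hWn _ (Finset.mem_of_mem_erase hx)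
    exact h.exchange_swap hu hv hv' (Or.inr (Or.inl hp))
      (orderKey_exchange_lt h.injective hv (hmax u hu hu')
        (by rw [hp.typeIndex_eq, hW.typeIndex_eq]))
  · rw [hC.typeIndex_eq, hW.typeIndex_eq] at hk'
    omega

lemma isPathType_swap_first {W : Finset σ} (hW : IsFirstType r M π W) {a : σ} (haM : π a = M + 1)
    {v : σ} (hvM : π v ≤ M)
    (hex : (∃ x ∈ insert v (W.erase a), π x ≤ r) ∨
      ∃ y ∈ insert v (W.erase a), ∃ z ∉ insert v (W.erase a), r + 1 < π z ∧ π z < π y) :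
    IsPathType r M π (insert v (W.erase a)) := by
  have h4 := h.add_four_le
  obtain ⟨_, ⟨c, hc, hcr⟩, hWn⟩ := hW
  have hca : c ≠ a := fun e => by rw [e] at hcr; omega
  have hc' : c ∈ insert v (W.erase a) := by simp [hc, hca]
  refine ⟨fun x hx => ?_, ?_⟩
  · rcases Finset.mem_insert.1 hx with rfl | hx
    · exact hvM
    · rw [Finset.mem_erase] at hx
      have h1 := h.le x
      have h2 := hWn x hx.2
      have h3 : π x ≠ π a := fun e => hx.1 (h.injective e)
      omega
  · rcases hex with ⟨x, hx, hxr⟩ | ⟨y, hy, z, hz, hrz, hzy⟩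
    · exact Or.inl ⟨x, hx, c, hc', hxr, by omega⟩
    · exact Or.inr ⟨c, hc', y, hy, z, hz, by omega, by omega, hzy⟩

/-- Trading `M + 1` for a new vertex with label at most `M`, other than `r + 2`, keeps `r + 1`
isolated and gives path type. What remains is a `W'` adding only `r + 2`, `M + 1` or `M + 2`; the
delicate case is the last type containing `r + 2`. -/
lemma exchange_first {W W' : Finset σ} (hW : IsFirstType r M π W) (hs : W.card ≠ M - r)
    (hW' : IsPathType r M π W' ∨ IsLastType M π W' ∨ IsFirstType r M π W')
    (hc : W'.card = W.card) (hk : orderKey M π W' < orderKey M π W) : Exchange G M π W W' := by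
  have h4 := h.add_four_le
  have hk' := (orderKey_lt_iff h.injective).1 hk
  obtain ⟨⟨a, ha, haM⟩, ⟨c, hc', hcr⟩, hWn⟩ := id hW
  obtain ⟨z, hz⟩ := h.exists_eq (r + 2) (by omega) (by omega)
  have hzW : z ∉ W := fun hzW => (hWn z hzW).1 hz
  have hswap : ∀ v ∈ W', v ∉ W → IsPathType r M π (insert v (W.erase a)) →
      Exchange G M π W W' := fun v hv' hv hp => by
    refine h.exchange_swap ha hv hv' (Or.inl hp) ((orderKey_lt_iff h.injective).2 (Or.inl ?_))
    rw [hp.typeIndex_eq, hW.typeIndex_eq]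
    exact two_pos
  by_cases hex : ∃ v ∈ W', v ∉ W ∧ π v ≠ r + 2 ∧ π v ≤ M
  · obtain ⟨v, hv', hv, hvr, hvM⟩ := hex
    refine hswap v hv' hv (h.isPathType_swap_first hW haM hvM ?_)
    have hvc : π v ≠ r + 1 := fun e => hv (h.injective (e.trans hcr.symm) ▸ hc')
    rcases Nat.lt_or_ge r (π v) with hr | hr
    · refine Or.inr ⟨v, by simp, z, fun hzm => ?_, by omega, by omega⟩
      rcases Finset.mem_insert.1 hzm with rfl | hzm
      · exact hvr hz
      · exact hzW (Finset.mem_of_mem_erase hzm)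
    · exact Or.inl ⟨v, by simp, hr⟩
  push Not at hex
  rcases id hW' with hA | hB | hC
  · refine exchange_self ((h.isDisconnectedOn_iff _).2 hW') hc hk (v := z)
      (subset_insert_of_forall fun x hx hxW => h.injective ?_)
    by_contra hne
    exact absurd (hex x hx hxW (fun e => hne (e.trans hz.symm))) (not_lt.2 (hA.1 x hx))
  · obtain ⟨⟨b, hb, hbM⟩, ⟨d, hd, hdM⟩, hWn'⟩ := id hB
    by_cases hzW' : z ∈ W'
    · have hdW : d ∈ W := by
        by_contra hdW
        have := hex d hd hdW (by omega)
        omega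
      refine hswap z hzW' hzW (h.isPathType_swap_first hW haM (by omega) ?_)
      by_contra! hno
      obtain ⟨hno₁, hno₂⟩ := hno
      have hda : d ≠ a := fun e => by rw [e] at hdM; omega
      -- With no clique vertex and no gap, a set containing `r + 1` and `M` is the whole path. Its
      -- `M - r` elements are the size excluded by `hs`.
      have himg : (insert z (W.erase a)).image π = Finset.Ioc r M := by
        ext i
        rw [Finset.mem_image, Finset.mem_Ioc]
        constructor
        · rintro ⟨x, hx, rfl⟩
          refine ⟨hno₁ x hx, ?_⟩
          rcases Finset.mem_insert.1 hx with rfl | hx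
          · omega
          · rw [Finset.mem_erase] at hx
            have h1 := h.le x
            have h2 := hWn x hx.2
            have h3 : π x ≠ π a := fun e => hx.1 (h.injective e)
            omega
        · rintro ⟨h1, h2⟩
          obtain ⟨x, hx⟩ := h.exists_eq i (by omega) (by omega)
          refine ⟨x, ?_, hx⟩
          by_contra hxn
          have hxd : π x ≠ π d := fun e => hxn (by
            rw [h.injective e]
            simp [hdW, hda])
          have hxc : π x ≠ π c := fun e => hxn (by
            rw [h.injective e]
            have hca : c ≠ a := fun e => by rw [e] at hcr; omega
            simp [hc', hca])
          have := hno₂ d (by simp [hdW, hda]) x hxn (by omega)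
          omega
      have hcard := congrArg Finset.card himg
      rw [Finset.card_image_of_injective _ h.injective, card_insert_erase ha hzW,
        Nat.card_Ioc] at hcard
      exact hs hcard
    · refine exchange_self ((h.isDisconnectedOn_iff _).2 hW') hc hk (v := b)
        (subset_insert_of_forall fun x hx hxW => h.injective ?_)
      have h1 : π x ≠ r + 2 := fun e => hzW' (h.injective (hz.trans e.symm) ▸ hx)
      have h2 := hex x hx hxW h1
      have h3 := hWn' x hx
      have h5 := h.le x
      omega
  · rw [hC.typeIndex_eq, hW.typeIndex_eq] at hk'
    obtain ⟨-, v, hv', hv, hmax⟩ := hk'.resolve_left (lt_irrefl _)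
    obtain ⟨u, hu, hu'⟩ : ∃ u ∈ W, u ∉ W' := by
      by_contra! hsub
      have := Finset.eq_of_subset_of_card_le hsub hc.le
      exact hv (this ▸ hv')
    obtain ⟨⟨a', ha', haM'⟩, ⟨c', hc'', hcr'⟩, hWn'⟩ := hC
    have hua : a ≠ u := fun e => hu' (e ▸ h.injective (haM'.trans haM.symm) ▸ ha')
    have huc : c ≠ u := fun e => hu' (e ▸ h.injective (hcr'.trans hcr.symm) ▸ hc'')
    have hp : IsFirstType r M π (insert v (W.erase u)) := by
      refine ⟨⟨a, by simp [ha, hua], haM⟩, ⟨c, by simp [hc', huc], hcr⟩, fun x hx => ?_⟩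
      rcases Finset.mem_insert.1 hx with rfl | hx
      · exact hWn' _ hv'
      · exact hWn _ (Finset.mem_of_mem_erase hx)
    exact h.exchange_swap hu hv hv' (Or.inr (Or.inr hp))
      (orderKey_exchange_lt h.injective hv (hmax u hu hu')
        (by rw [hp.typeIndex_eq, hW.typeIndex_eq]))

lemma exchange {W W' : Finset σ} (hW : IsDisconnectedOn G W) (hW' : IsDisconnectedOn G W')
    (hs : W.card ≠ M - r) (hc : W'.card = W.card) (hk : orderKey M π W' < orderKey M π W) :
    Exchange G M π W W' := by
  rw [h.isDisconnectedOn_iff] at hW hW'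
  rcases hW with hA | hB | hC
  · rcases id hW' with hA' | hB' | hC'
    · exact h.exchange_path hA hA' hc hk
    · have hk' := (orderKey_lt_iff h.injective).1 hk
      rw [hB'.typeIndex_eq, hA.typeIndex_eq] at hk'
      omega
    · have hk' := (orderKey_lt_iff h.injective).1 hk
      rw [hC'.typeIndex_eq, hA.typeIndex_eq] at hk'
      omega
  · exact h.exchange_last hB hW' hc hk
  · exact h.exchange_first hC hs hW' hc hk

theorem hasLinearQuotients (K : Type*) [Field K] [Finite σ] {s : ℕ} (hs : s ≠ M - r) :
    HasLinearQuotients (sqfreeIdeal K {W : Finset σ | W.card = s ∧ IsDisconnectedOn G W}) := by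
  classical
  have := Fintype.ofFinite σ
  have hS : ((Finset.univ.filter fun W : Finset σ => W.card = s ∧ IsDisconnectedOn G W :
      Finset (Finset σ)) : Set (Finset σ)) = {W | W.card = s ∧ IsDisconnectedOn G W} := by
    ext W
    simp
  rw [← hS]
  refine hasLinearQuotients_of_exchange (s := s) (by simp +contextual) (orderKey M π)
    (orderKey_injective h.injective).injOn ?_
  simp only [Finset.mem_filter, Finset.mem_univ, true_and]
  rintro W ⟨rfl, hW⟩ W' ⟨hc, hW'⟩ hk
  exact h.exchange hW hW' hs hc hk

end IsCHLabelling

end Exchange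

/-! ### Sizes of the generators, the exceptional size and the graph `CH n r` -/

section Main

variable {σ : Type*} [DecidableEq σ]

/-- The vertices with labels in `T`. -/
def labelled [Fintype σ] (π : σ → ℕ) (T : Finset ℕ) : Finset σ :=
  Finset.univ.filter (π · ∈ T)

omit [DecidableEq σ] in
lemma mem_labelled [Fintype σ] {π : σ → ℕ} {T : Finset ℕ} {v : σ} :
    v ∈ labelled π T ↔ π v ∈ T := by
  simp [labelled]

namespace IsCHLabelling

variable {G : SimpleGraph σ} {r M : ℕ} {π : σ → ℕ} (h : IsCHLabelling G r M π)
include h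

omit [DecidableEq σ] in
lemma exists_eq_of_mem {T : Finset ℕ} (hT : T ⊆ Finset.Icc 1 (M + 2)) {i : ℕ} (hi : i ∈ T) :
    ∃ v, π v = i :=
  have := Finset.mem_Icc.1 (hT hi)
  h.exists_eq i this.1 this.2

omit [DecidableEq σ] in
lemma card_labelled [Fintype σ] {T : Finset ℕ} (hT : T ⊆ Finset.Icc 1 (M + 2)) :
    (labelled π T).card = T.card := by
  rw [← Finset.card_image_of_injective _ h.injective]
  congr 1
  ext i
  rw [Finset.mem_image]
  constructor
  · rintro ⟨v, hv, rfl⟩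
    exact mem_labelled.1 hv
  · intro hi
    obtain ⟨v, rfl⟩ := h.exists_eq_of_mem hT hi
    exact ⟨v, mem_labelled.2 hi, rfl⟩

/-- Take `M`, `M + 2` and any `s - 2` labels up to `M - 2`: then `M` is isolated. -/
lemma exists_isDisconnectedOn [Fintype σ] {s : ℕ} (hs : 2 ≤ s) (hsM : s ≤ M) :
    ∃ W : Finset σ, W.card = s ∧ IsDisconnectedOn G W := by
  have h4 := h.add_four_le
  obtain ⟨R, hR, hRc⟩ := Finset.exists_subset_card_eq
    (show s - 2 ≤ (Finset.Icc 1 (M - 2)).card by rw [Nat.card_Icc]; omega)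
  have hR' : ∀ i ∈ R, 1 ≤ i ∧ i ≤ M - 2 := fun i hi => Finset.mem_Icc.1 (hR hi)
  have hMR : M ∉ R := fun hi => by have := hR' M hi; omega
  have hMR' : M + 2 ∉ insert M R := fun hi => by
    rcases Finset.mem_insert.1 hi with hi | hi
    · omega
    · have := hR' _ hi; omega
  have hsub : insert (M + 2) (insert M R) ⊆ Finset.Icc 1 (M + 2) := fun i hi => by
    rw [Finset.mem_insert, Finset.mem_insert] at hi
    rw [Finset.mem_Icc]
    rcases hi with rfl | rfl | hi
    · omega
    · omega
    · have := hR' i hi; omega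
  refine ⟨labelled π (insert (M + 2) (insert M R)), ?_, ?_⟩
  · rw [h.card_labelled hsub, Finset.card_insert_of_notMem hMR', Finset.card_insert_of_notMem hMR,
      hRc]
    omega
  · rw [h.isDisconnectedOn_iff]
    obtain ⟨b, hb⟩ := h.exists_eq (M + 2) (by omega) (by omega)
    obtain ⟨c, hc⟩ := h.exists_eq M (by omega) (by omega)
    refine Or.inr (Or.inl ⟨⟨b, mem_labelled.2 (by simp [hb]), hb⟩,
      ⟨c, mem_labelled.2 (by simp [hc]), hc⟩, fun v hv => ?_⟩)
    rw [mem_labelled, Finset.mem_insert, Finset.mem_insert] at hv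
    rcases hv with hv | hv | hv
    · omega
    · omega
    · have := hR' _ hv; omega

/-- Each type avoids two of the `M + 2` labels. -/
lemma card_le_of_isDisconnectedOn {W : Finset σ} (hW : IsDisconnectedOn G W) : W.card ≤ M := by
  have h4 := h.add_four_le
  rw [← Finset.card_image_of_injective _ h.injective]
  have key : ∀ T : Finset ℕ, T.card = M → (∀ v ∈ W, π v ∈ T) → (W.image π).card ≤ M :=
    fun T hT hWT => hT ▸ Finset.card_le_card (Finset.image_subset_iff.2 hWT)
  rcases (h.isDisconnectedOn_iff W).1 hW with hA | hB | hC
  · exact key (Finset.Icc 1 M) (by simp) fun v hv =>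
      Finset.mem_Icc.2 ⟨h.one_le v, hA.1 v hv⟩
  · refine key (((Finset.Icc 1 (M + 2)).erase (M - 1)).erase (M + 1)) ?_ fun v hv => ?_
    · rw [Finset.card_erase_of_mem, Finset.card_erase_of_mem, Nat.card_Icc]
      · omega
      · rw [Finset.mem_Icc]; omega
      · rw [Finset.mem_erase, Finset.mem_Icc]; omega
    · have h1 := hB.2.2 v hv
      have h2 := h.one_le v
      have h3 := h.le v
      rw [Finset.mem_erase, Finset.mem_erase, Finset.mem_Icc]
      omega
  · refine key (((Finset.Icc 1 (M + 2)).erase (r + 2)).erase (M + 2)) ?_ fun v hv => ?_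
    · rw [Finset.card_erase_of_mem, Finset.card_erase_of_mem, Nat.card_Icc]
      · omega
      · rw [Finset.mem_Icc]; omega
      · rw [Finset.mem_erase, Finset.mem_Icc]; omega
    · have h1 := hC.2.2 v hv
      have h2 := h.one_le v
      have h3 := h.le v
      rw [Finset.mem_erase, Finset.mem_erase, Finset.mem_Icc]
      omega

/-- The witnesses are the largest sets of last and first type disjoint from the clique. They differ
by `{r + 2, M + 2}` and `{M - 1, M + 1}`; these have two elements each, and `r + 4 ≤ M` keeps `r +
2` and `M - 1` apart. -/
theorem not_hasLinearQuotients (K : Type*) [Field K] [Fintype σ] :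
    ¬ HasLinearQuotients (sqfreeIdeal K {W : Finset σ | W.card = M - r ∧
      IsDisconnectedOn G W}) := by
  have h4 := h.add_four_le
  set T₁ := ((Finset.Ioc r (M + 2)).erase (M - 1)).erase (M + 1) with hT₁
  set T₂ := ((Finset.Ioc r (M + 2)).erase (r + 2)).erase (M + 2) with hT₂
  have m₁ : ∀ i, i ∈ T₁ ↔ i ≠ M + 1 ∧ i ≠ M - 1 ∧ r < i ∧ i ≤ M + 2 := by simp [hT₁]
  have m₂ : ∀ i, i ∈ T₂ ↔ i ≠ M + 2 ∧ i ≠ r + 2 ∧ r < i ∧ i ≤ M + 2 := by simp [hT₂]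
  have c₁ : (labelled π T₁).card = M - r := by
    rw [h.card_labelled, hT₁, Finset.card_erase_of_mem, Finset.card_erase_of_mem, Nat.card_Ioc]
    · omega
    · rw [Finset.mem_Ioc]; omega
    · rw [Finset.mem_erase, Finset.mem_Ioc]; omega
    · intro i hi; rw [m₁] at hi; rw [Finset.mem_Icc]; omega
  have c₂ : (labelled π T₂).card = M - r := by
    rw [h.card_labelled, hT₂, Finset.card_erase_of_mem, Finset.card_erase_of_mem, Nat.card_Ioc]
    · omega
    · rw [Finset.mem_Ioc]; omega
    · rw [Finset.mem_erase, Finset.mem_Ioc]; omega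
    · intro i hi; rw [m₂] at hi; rw [Finset.mem_Icc]; omega
  obtain ⟨b, hb⟩ := h.exists_eq (M + 2) (by omega) (by omega)
  obtain ⟨a, ha⟩ := h.exists_eq (M + 1) (by omega) (by omega)
  obtain ⟨c, hc⟩ := h.exists_eq M (by omega) (by omega)
  obtain ⟨c', hc'⟩ := h.exists_eq (M - 1) (by omega) (by omega)
  obtain ⟨d, hd⟩ := h.exists_eq (r + 1) (by omega) (by omega)
  obtain ⟨d', hd'⟩ := h.exists_eq (r + 2) (by omega) (by omega)
  refine not_hasLinearQuotients_of_pair (s := M - r) (fun W hW => hW.1)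
    (W₁ := labelled π T₁) (W₂ := labelled π T₂) ⟨c₁, ?_⟩ ⟨c₂, ?_⟩ ?_ ?_ ?_
  · rw [h.isDisconnectedOn_iff]
    refine Or.inr (Or.inl ⟨⟨b, ?_, hb⟩, ⟨c, ?_, hc⟩, fun v hv => ?_⟩)
    · rw [mem_labelled, m₁]; omega
    · rw [mem_labelled, m₁]; omega
    · rw [mem_labelled, m₁] at hv; omega
  · rw [h.isDisconnectedOn_iff]
    refine Or.inr (Or.inr ⟨⟨a, ?_, ha⟩, ⟨d, ?_, hd⟩, fun v hv => ?_⟩)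
    · rw [mem_labelled, m₂]; omega
    · rw [mem_labelled, m₂]; omega
    · rw [mem_labelled, m₂] at hv; omega
  · refine Finset.one_lt_card.2 ⟨b, ?_, d', ?_, fun e => by rw [e] at hb; omega⟩ <;>
      rw [Finset.mem_sdiff, mem_labelled, mem_labelled, m₁, m₂] <;> omega
  · refine Finset.one_lt_card.2 ⟨a, ?_, c', ?_, fun e => by rw [e] at ha; omega⟩ <;>
      rw [Finset.mem_sdiff, mem_labelled, mem_labelled, m₁, m₂] <;> omega
  · rintro W ⟨hWc, hW⟩ hsub
    have hr : ∀ v ∈ W, r < π v := fun v hv => by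
      have := hsub hv
      rw [Finset.mem_union, mem_labelled, mem_labelled, m₁, m₂] at this
      omega
    rcases (h.isDisconnectedOn_iff W).1 hW with
      ⟨hM, ⟨x, hx, _, _, hxr, _⟩ | ⟨x, hx, y, hy, z, hz, hxr, hxz, hzy⟩⟩ | hB | hC
    · exact absurd (hr x hx) (not_lt.2 hxr)
    -- A set of `M - r` path vertices is the whole path and has no gap.
    · refine absurd ?_ hz
      have hsub' : W ⊆ labelled π (Finset.Ioc r M) := fun v hv =>
        mem_labelled.2 (Finset.mem_Ioc.2 ⟨hr v hv, hM v hv⟩)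
      rw [Finset.eq_of_subset_of_card_le hsub' (by
        rw [h.card_labelled fun i hi => ?_, Nat.card_Ioc, hWc]
        rw [Finset.mem_Ioc] at hi
        rw [Finset.mem_Icc]
        omega), mem_labelled, Finset.mem_Ioc]
      have := hM y hy
      omega
    · left
      refine Finset.eq_of_subset_of_card_le (fun v hv => ?_) (by rw [c₁, hWc])
      have h1 := hB.2.2 v hv
      have h2 := hr v hv
      have h3 := h.le v
      rw [mem_labelled, m₁]
      omega
    · right
      refine Finset.eq_of_subset_of_card_le (fun v hv => ?_) (by rw [c₂, hWc])
      have h1 := hC.2.2 v hv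
      have h2 := hr v hv
      have h3 := h.le v
      rw [mem_labelled, m₂]
      omega

end IsCHLabelling

omit [DecidableEq σ] in
lemma sqfreeIdeal_ne_bot {K : Type*} [Field K] {S : Set (Finset σ)} {W : Finset σ} (hW : W ∈ S) :
    sqfreeIdeal K S ≠ ⊥ := by
  intro h
  have h1 : monomial (sqfreeExp W) (1 : K) ∈ sqfreeIdeal K S :=
    Ideal.subset_span ⟨_, ⟨W, hW, rfl⟩, rfl⟩
  rw [h, Ideal.mem_bot, monomial_eq_zero] at h1
  exact one_ne_zero h1

lemma HEdge.iff_of_le {n r a b : ℕ} :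
    (∃ i j, HEdge n i j ∧ a = r + i ∧ b = r + j) ↔ r ≤ a ∧ r ≤ b ∧ HEdge n (a - r) (b - r) := by
  constructor
  · rintro ⟨i, j, h, rfl, rfl⟩
    simpa using h
  · rintro ⟨h1, h2, h⟩
    exact ⟨_, _, h, by omega, by omega⟩

/-- The label of a vertex of `CH n r`, with `r + n - 3` and `r + n - 2` exchanged, so that the
path is in its natural order. -/
def pathLabel (n r : ℕ) (v : Fin (r + n)) : ℕ :=
  if (v : ℕ) + 1 = r + n - 3 then r + n - 2
  else if (v : ℕ) + 1 = r + n - 2 then r + n - 3 else v + 1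

lemma CH_adj_iff {n r : ℕ} (u v : Fin (r + n)) : (CH n r).Adj u v ↔
    u ≠ v ∧ (CHEdge n r (u + 1) (v + 1) ∨ CHEdge n r (v + 1) (u + 1)) :=
  SimpleGraph.fromRel_adj _ _ _

lemma CH_adj_iff_of_lt {n r : ℕ} (hn : 6 ≤ n) {u v : Fin (r + n)} (huv : u < v) :
    (CH n r).Adj u v ↔ (v : ℕ) + 1 ≤ r ∨
      (r < (u : ℕ) + 1 ∧ (v : ℕ) = u + 1 ∧ (v : ℕ) + 1 ≤ r + n - 4) ∨
      ((u : ℕ) + 1 = r + n - 4 ∧ (v : ℕ) + 1 = r + n - 2) ∨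
      ((u : ℕ) + 1 = r + n - 3 ∧ (v : ℕ) + 1 = r + n - 2) ∨
      ((v : ℕ) + 1 = r + n - 1 ∧ (u : ℕ) ≠ r) ∨
      ((v : ℕ) + 1 = r + n ∧ (u : ℕ) + 1 ≠ r + n - 3) := by
  have h1 : u ≠ v := ne_of_lt huv
  have h2 : (u : ℕ) < v := huv
  have h3 := v.2
  rw [CH_adj_iff]
  simp only [CHEdge, HEdge.iff_of_le, ne_eq, h1, not_false_eq_true, true_and]
  constructor
  · rintro ((⟨h4, h5, h | h | h | h | h⟩ | h | h) | (⟨h4, h5, h | h | h | h | h⟩ | h | h)) <;> omega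
  · rintro (h | h | h | h | ⟨h, h'⟩ | ⟨h, h'⟩)
    · exact Or.inl (Or.inr (Or.inl (by omega)))
    · exact Or.inl (Or.inl ⟨by omega, by omega, Or.inl (by omega)⟩)
    · exact Or.inl (Or.inl ⟨by omega, by omega, Or.inr (Or.inl (by omega))⟩)
    · exact Or.inr (Or.inl ⟨by omega, by omega, Or.inr (Or.inr (Or.inl (by omega)))⟩)
    · rcases Nat.lt_or_ge r ((u : ℕ) + 1) with hr | hr
      · exact Or.inr (Or.inl ⟨by omega, by omega, Or.inr (Or.inr (Or.inr (Or.inl (by omega))))⟩)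
      · exact Or.inl (Or.inr (Or.inr (by omega)))
    · rcases Nat.lt_or_ge r ((u : ℕ) + 1) with hr | hr
      · exact Or.inr (Or.inl ⟨by omega, by omega, Or.inr (Or.inr (Or.inr (Or.inr (by omega))))⟩)
      · exact Or.inl (Or.inr (Or.inr (by omega)))

lemma isCHLabelling_CH {n r : ℕ} (hn : 6 ≤ n) :
    IsCHLabelling (CH n r) r (r + n - 2) (pathLabel n r) where
  injective u v h := by
    unfold pathLabel at h
    ext
    split_ifs at h <;> omega
  one_le v := by unfold pathLabel; split_ifs <;> omega
  le v := by unfold pathLabel; have := v.2; split_ifs <;> omega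
  exists_eq i h1 h2 := by
    unfold pathLabel
    by_cases h3 : i = r + n - 2
    · exact ⟨⟨r + n - 4, by omega⟩, by simp only; split_ifs <;> omega⟩
    by_cases h4 : i = r + n - 3
    · exact ⟨⟨r + n - 3, by omega⟩, by simp only; split_ifs <;> omega⟩
    · exact ⟨⟨i - 1, by omega⟩, by simp only; split_ifs <;> omega⟩
  adj_iff u v h := by
    have h3 := v.2
    have h4 := u.2
    rcases lt_trichotomy u v with huv | rfl | huv
    · have h5 : (u : ℕ) < v := huv
      rw [CH_adj_iff_of_lt hn huv]
      unfold pathLabel at *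
      split_ifs at * <;> omega
    · exact absurd h (lt_irrefl _)
    · have h5 : (v : ℕ) < u := huv
      rw [(CH n r).adj_comm, CH_adj_iff_of_lt hn huv]
      unfold pathLabel at *
      split_ifs at * <;> omega
  add_four_le := by omega

/-- The original numbering is a perfect elimination order, so the least vertex is simplicial. The
path order is not: there `M - 1` would precede its nonadjacent neighbours `M` and `M + 2`. -/
lemma isChordal_CH {n r : ℕ} (hn : 6 ≤ n) : IsChordal (CH n r) := by
  have key : ∀ v x y : Fin (r + n), v < x → x < y → (CH n r).Adj v x → (CH n r).Adj v y →
      (CH n r).Adj x y := by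
    intro v x y hvx hxy h1 h2
    rw [CH_adj_iff_of_lt hn hvx] at h1
    rw [CH_adj_iff_of_lt hn (hvx.trans hxy)] at h2
    rw [CH_adj_iff_of_lt hn hxy]
    have h3 : (v : ℕ) < x := hvx
    have h4 : (x : ℕ) < y := hxy
    have h5 := y.2
    omega
  intro W hW
  refine ⟨W.min' hW, W.min'_mem hW, fun x hx y hy h1 h2 hne => ?_⟩
  have hvx := lt_of_le_of_ne (W.min'_le x hx) h1.ne
  have hvy := lt_of_le_of_ne (W.min'_le y hy) h2.ne
  rcases lt_or_gt_of_ne hne with hxy | hxy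
  · exact key _ x y hvx hxy h1 h2
  · exact (key _ y x hvy hxy h2 h1).symm

end Main

end
theorem theorem4p3 {K : Type*} [Field K] (n r : ℕ) (hn : 6 ≤ n) :
    (∀ k : ℕ, (2 ≤ k ∧ k < n - 4) ∨ (n - 4 < k ∧ k ≤ n + r - 4) →
      homologicalShiftIdeal k (edgeIdeal K (CH n r)ᶜ) ≠ ⊥ ∧
        HasLinearQuotients (homologicalShiftIdeal k (edgeIdeal K (CH n r)ᶜ))) ∧
    (homologicalShiftIdeal (n - 4) (edgeIdeal K (CH n r)ᶜ) ≠ ⊥ ∧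
      ¬ HasLinearQuotients (homologicalShiftIdeal (n - 4) (edgeIdeal K (CH n r)ᶜ))) ∧
    (∀ k : ℕ, n + r - 4 < k →
      homologicalShiftIdeal k (edgeIdeal K (CH n r)ᶜ) = ⊥) := by
  have hHS (k : ℕ) : homologicalShiftIdeal k (edgeIdeal K (CH n r)ᶜ) =
      sqfreeIdeal K {W | W.card = k + 2 ∧ IsDisconnectedOn (CH n r) W} :=
    homologicalShiftIdeal_edgeIdeal_compl (isChordal_CH hn) k
  have hL := isCHLabelling_CH (n := n) (r := r) hn
  have hne (k : ℕ) (hk : k ≤ n + r - 4) :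
      homologicalShiftIdeal k (edgeIdeal K (CH n r)ᶜ) ≠ ⊥ := by
    obtain ⟨W, hW⟩ := hL.exists_isDisconnectedOn (s := k + 2) (by omega) (by omega)
    rw [hHS]
    exact sqfreeIdeal_ne_bot hW
  refine ⟨fun k hk => ⟨hne k (by omega), ?_⟩, ⟨hne _ (by omega), ?_⟩, fun k hk => ?_⟩
  · rw [hHS]
    exact hL.hasLinearQuotients K (by omega)
  -- Homological degree `n - 4` means sets of `n - 2` vertices, the length `M - r` of the path.
  · rw [hHS, show n - 4 + 2 = r + n - 2 - r by omega]
    exact hL.not_hasLinearQuotients K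
  · have hS : {W : Finset (Fin (r + n)) | W.card = k + 2 ∧ IsDisconnectedOn (CH n r) W} = ∅ := by
      refine Set.eq_empty_of_forall_notMem fun W hW => ?_
      have := hL.card_le_of_isDisconnectedOn hW.2
      have := hW.1
      omega
    rw [hHS, hS, sqfreeIdeal, Set.image_empty, Set.image_empty, Ideal.span_empty]
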